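/- Call a group $\Gamma$ *crystallographic* if it admits a crystallographic action, that is, an embedding into $\mathrm{Isom}(\mathbb{R}^n)$, for some $n \geq 0$, with discrete image and with $\mathbb{R}^n/\Gamma$ compact. The *translation subgroup* of $\Gamma$ consists of the elements that act as translations in a crystallographic action (it does not depend on the choice of the action). Let $\mathcal{Z}_0$ be the class of non-trivial finitely generated free abelian groups. For $i \geq 1$, let $\mathcal{Z}_i$ be the class of torsion-free crystallographic groups $\Gamma$ that sit in an extension $$1 \to \mathbb{Z}^l \to \Gamma \to \Gamma' \to 1$$ with $l \ge 0$, $\Gamma' \in \mathcal{Z}_{i-1}$, and the image of $\mathbb{Z}^l$ contained in the translation subgroup of $\Gamma$. Put $\mathcal{Z} = \bigcup_{i \ge 0} \mathcal{Z}_i$. A *compact Euclidean space form* is a compact quotient $\mathbb{R}^n/G$, with its orbit space metric, where $G$ is a discrete group of isometries of $\mathbb{R}^n$ acting freely. It is a *flat torus* if $G$ is the group of translations by the vectors of a full-rank lattice in $\mathbb{R}^n$. A compact Euclidean space form $M$ *fibers geometrically* over a compact Euclidean space form $B$ with fiber $F$ if there is a continuous surjection $\eta : M \to B$ such that every $y \in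 B$ is the center of an open metric ball $U$ of positive radius for which there is a homeomorphism $\varphi : \eta^{-1}(U) \to F \times U$ that commutes with the projections to $U$ and is a local isometry, $F \times U$ being given the product metric. Let $\mathcal{T}_0$ be the family of flat tori of positive dimension. For $i \geq 1$, let $\mathcal{T}_i$ be the family of compact Euclidean space forms that fiber geometrically, with a flat torus as fiber, over some member of $\mathcal{T}_{i-1}$. The members of $\mathcal{T} = \bigcup_{i \ge 0} \mathcal{T}_i$ are called *flat iterated torus bundles*. **Proposition.** A (discrete) group $\Gamma$ lies in $\mathcal{Z}$ if and only if $\Gamma$ is isomorphic to the fundamental group of a flat iterated torus bundle. -/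

import Mathlib

open scoped Topology

universe u

/-- Euclidean space `ℝⁿ`. -/
abbrev Euc (n : ℕ) : Type := EuclideanSpace ℝ (Fin n)

/-- The isometry group `Isom(ℝⁿ)`; multiplication is composition. -/
abbrev EucIsom (n : ℕ) : Type := Euc n ≃ᵢ Euc n

/-- The tautological action of `Isom(ℝⁿ)` on `ℝⁿ`. -/
noncomputable instance EucIsom.mulAction (n : ℕ) : MulAction (EucIsom n) (Euc n) where
  smul g x := g x
  one_smul _ := rfl
  mul_smul _ _ _ := rfl

/-- An isometry is a translation. -/
def IsTranslation {n : ℕ} (g : EucIsom n) : Prop :=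
  ∃ v : Euc n, ∀ x : Euc n, g x = x + v

/-- Discreteness of a subgroup of `Isom(ℝⁿ)`, for the topology of pointwise convergence. On
`Isom(ℝⁿ)` this is the compact-open topology, and also the product topology of `ℝⁿ ⋊ O(n)`. -/
def IsDiscreteIsomSubgroup {n : ℕ} (G : Subgroup (EucIsom n)) : Prop :=
  DiscreteTopology ((fun (g : EucIsom n) (x : Euc n) => g x) '' (G : Set (EucIsom n)))

/-- The orbit space `ℝⁿ/G`; as a `Quotient` it carries the quotient topology. -/
abbrev EucOrbitSpace {n : ℕ} (G : Subgroup (EucIsom n)) : Type :=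
  Quotient (MulAction.orbitRel G (Euc n))

/-- The orbit space metric on `ℝⁿ/G`: the distance between two points is the distance between the
two orbits, as subsets of `ℝⁿ`. -/
noncomputable def orbitDist {n : ℕ} {G : Subgroup (EucIsom n)} (x y : EucOrbitSpace G) : ℝ :=
  sInf {d : ℝ | ∃ a b : Euc n, (Quotient.mk _ a : EucOrbitSpace G) = x ∧
    (Quotient.mk _ b : EucOrbitSpace G) = y ∧ d = dist a b}

/-! ### Crystallographic groups and the class `𝒵` -/

/-- A crystallographic action of dimension `n` of an abstract group: an embedding in `Isom(ℝⁿ)`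
with discrete image and compact orbit space. -/
structure IsCrystallographicAction {Γ : Type u} [Group Γ] {n : ℕ} (ρ : Γ →* EucIsom n) :
    Prop where
  injective : Function.Injective ρ
  discrete : IsDiscreteIsomSubgroup ρ.range
  compact : CompactSpace (EucOrbitSpace ρ.range)

/-- `IsClassZ i Γ` says that `Γ` lies in `𝒵ᵢ`. The class `𝒵₀` consists of the non-trivial finitely
generated free abelian groups. The class `𝒵ᵢ₊₁` consists of the torsion-free crystallographic
groups `Γ` in an extension `1 → ℤˡ → Γ → Γ' → 1` with `Γ'` in `𝒵ᵢ` and the image of `ℤˡ` contained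
in the translation subgroup of `Γ`, that is, in the subgroup of those elements which a
crystallographic action sends to translations; this subgroup is the same for every
crystallographic action of `Γ`. -/
def IsClassZ : ℕ → ∀ (Γ : Type u) [Group Γ], Prop
  | 0, Γ, _ => Nontrivial Γ ∧ ∃ k : ℕ, Nonempty (Γ ≃* Multiplicative (Fin k → ℤ))
  | i + 1, Γ, _ =>
      (∀ g : Γ, g ≠ 1 → ¬ IsOfFinOrder g) ∧
      ∃ (n : ℕ) (ρ : Γ →* EucIsom n), IsCrystallographicAction ρ ∧
      ∃ (l : ℕ) (Γ' : Type u) (_ : Group Γ')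
        (ι : Multiplicative (Fin l → ℤ) →* Γ) (p : Γ →* Γ'),
        Function.Injective ι ∧ Function.Surjective p ∧ ι.range = p.ker ∧
        IsClassZ i Γ' ∧ ∀ z, IsTranslation (ρ (ι z))

/-! ### Euclidean space forms and flat iterated torus bundles -/

/-- A compact Euclidean space form `ℝⁿ/G`: here `G` is a discrete group of isometries of `ℝⁿ` that
acts freely and with compact orbit space. -/
structure EuclideanSpaceForm where
  dim : ℕ
  group : Subgroup (EucIsom dim)
  discrete : IsDiscreteIsomSubgroup group
  free : ∀ g ∈ group, ∀ x : Euc dim, g x = x → g = 1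
  compact : CompactSpace (EucOrbitSpace group)

namespace EuclideanSpaceForm

/-- The underlying space `ℝⁿ/G`. -/
abbrev Carrier (M : EuclideanSpaceForm) : Type := EucOrbitSpace M.group

/-- `M` is a flat torus `ℝᵏ/L`, for a lattice `L` of full rank in `ℝᵏ` acting by translations. -/
def IsFlatTorus (M : EuclideanSpaceForm) : Prop :=
  ∃ (L : Submodule ℤ (Euc M.dim)) (_ : DiscreteTopology L), IsZLattice ℝ L ∧
    ∀ g : EucIsom M.dim, g ∈ M.group ↔ ∃ v ∈ L, ∀ x : Euc M.dim, g x = x + v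

/-- The open metric ball in a space form. -/
def metricBall (B : EuclideanSpaceForm) (y : B.Carrier) (r : ℝ) : Set B.Carrier :=
  {z | orbitDist y z < r}

/-- `M` fibers geometrically over `B` with fiber `F`: there is a continuous surjection `η : M → B`
such that every `y ∈ B` is the center of a metric ball `U` of positive radius over which `η` is
isometrically equivalent to the projection `F × U → U`. Isometries are taken in the sense of flat
Riemannian manifolds: the trivialization `φ` is a homeomorphism over `U` which near every point
preserves distances, the product `F × U` having the product (`ℓ²`) metric. -/
def GeometricallyFibers (M B F : EuclideanSpaceForm) : Prop :=
  ∃ η : M.Carrier → B.Carrier, Continuous η ∧ Function.Surjective η ∧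
    ∀ y : B.Carrier, ∃ r : ℝ, 0 < r ∧
      ∃ φ : (η ⁻¹' B.metricBall y r) ≃ₜ F.Carrier × B.metricBall y r,
        (∀ p, ((φ p).2 : B.Carrier) = η p) ∧
        ∀ p, ∃ W ∈ 𝓝 p, ∀ a b : η ⁻¹' B.metricBall y r, a ∈ W → b ∈ W →
          orbitDist a.1 b.1 ^ 2 =
            orbitDist (φ a).1 (φ b).1 ^ 2 +
              orbitDist ((φ a).2 : B.Carrier) ((φ b).2 : B.Carrier) ^ 2

/-- `M.IsIteratedTorusBundle i` says that `M` lies in `𝒯ᵢ`. The family `𝒯₀` consists of the flat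
tori of positive dimension; `𝒯ᵢ₊₁` consists of the space forms that fiber geometrically over a
space form in `𝒯ᵢ` with a flat torus as fiber. -/
def IsIteratedTorusBundle : ℕ → EuclideanSpaceForm → Prop
  | 0, M => 0 < M.dim ∧ M.IsFlatTorus
  | i + 1, M => ∃ B F : EuclideanSpaceForm,
      IsIteratedTorusBundle i B ∧ F.IsFlatTorus ∧ M.GeometricallyFibers B F

end EuclideanSpaceForm

/-! The covering `ℝⁿ → ℝⁿ/G` identifies the fundamental group of a space form with its group `G`, so
both directions are inductions on the level about groups of isometries.

From bundles to groups: a geometric fibering `η : M → B` lifts to a map `f` of universal covers.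
Local product metrics make `f` locally affine, hence affine, and `f` is onto because `η` is open. It
is equivariant along a homomorphism `θ : M.group →* B.group`, which is surjective because the fibers
of `η` are connected. Let `g ∈ ker θ` have linear part `A`, and let `V` be the kernel of the linear
part of `f`. A leaf of `f` in direction `V` develops into the universal cover of the torus fiber,
where `g` becomes a deck transformation, that is, a translation; hence `A = 1` on `V`. Since `f` is
`g`-invariant, `A x - x ∈ V` for all `x`, and orthogonality of `A` yields `A x = x`. So `ker θ`
consists of translations (`isTranslation_of_lift_invariant`).

From groups to bundles: let `N = ker (Γ → Γ')` act by translations, with span `V`. As `N` is normal,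
linear parts of `Γ` preserve `V`, and orthogonal projection gives an action `σ` of `Γ` on `V` in
which `N` acts as a lattice (`exists_fiber_action`). If `B = ℝᵐ/Γ'` is given by induction, `Γ` acts
diagonally on `V × ℝᵐ`, freely, discretely and cocompactly, and the quotient fibers geometrically
over `B` with fiber `V/N` (`geometricallyFibers_totalSpace`). -/

/-! ### Discrete groups of isometries -/

section Discreteness

variable {n : ℕ} {G : Subgroup (EucIsom n)}

/-- A basic neighbourhood of the identity for pointwise convergence constrains only finitely many
points. -/
theorem IsDiscreteIsomSubgroup.exists_finset (hG : IsDiscreteIsomSubgroup G) :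
    ∃ (s : Finset (Euc n)) (ε : ℝ), 0 < ε ∧
      ∀ g ∈ G, (∀ x ∈ s, dist (g x) x < ε) → g = 1 := by
  unfold IsDiscreteIsomSubgroup at hG
  have hone : (fun x : Euc n => x) ∈
      (fun (g : EucIsom n) (x : Euc n) => g x) '' (G : Set (EucIsom n)) := ⟨1, G.one_mem, rfl⟩
  obtain ⟨U, hU, hUS⟩ := isOpen_induced_iff.1
    (isOpen_discrete ({⟨_, hone⟩} : Set ((fun (g : EucIsom n) (x : Euc n) => g x) '' (G : Set _))))
  have hmem : (fun x : Euc n => x) ∈ U := by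
    have : (⟨_, hone⟩ : ((fun (g : EucIsom n) (x : Euc n) => g x) '' (G : Set _))) ∈
      Subtype.val ⁻¹' U := by rw [hUS]; rfl
    exact this
  obtain ⟨s, u, hu, hsub⟩ := isOpen_pi_iff.1 hU _ hmem
  have hball : ∀ x : Euc n, ∃ ε : ℝ, 0 < ε ∧ (x ∈ s → Metric.ball x ε ⊆ u x) := by
    intro x
    by_cases hx : x ∈ s
    · obtain ⟨ε, h0, h⟩ := Metric.isOpen_iff.1 (hu x hx).1 x (hu x hx).2
      exact ⟨ε, h0, fun _ => h⟩
    · exact ⟨1, one_pos, fun h => absurd h hx⟩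
  choose e he0 he using hball
  obtain ⟨ε, hε0, hε⟩ : ∃ ε : ℝ, 0 < ε ∧ ∀ x ∈ s, ε ≤ e x := by
    rcases s.eq_empty_or_nonempty with rfl | hs
    · exact ⟨1, one_pos, by simp⟩
    · obtain ⟨x, hx, hmin⟩ := s.exists_min_image e hs
      exact ⟨e x, he0 x, hmin⟩
  refine ⟨s, ε, hε0, fun g hg h => ?_⟩
  have hgU : (fun x => g x) ∈ U := hsub fun x hx =>
    he x hx (Metric.mem_ball.2 ((h x hx).trans_le (hε x hx)))
  have : (⟨fun x => g x, g, hg, rfl⟩ :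
      ((fun (g : EucIsom n) (x : Euc n) => g x) '' (G : Set _))) ∈ Subtype.val ⁻¹' U := hgU
  rw [hUS] at this
  ext1 x
  exact congrFun (congrArg Subtype.val this) x

theorem IsDiscreteIsomSubgroup.of_displacement (x : Euc n) (ε : ℝ) (hε : 0 < ε)
    (h : ∀ g ∈ G, dist (g x) x < ε → g = 1) : IsDiscreteIsomSubgroup G := by
  unfold IsDiscreteIsomSubgroup
  rw [discreteTopology_iff_isOpen_singleton]
  rintro ⟨_, g, hg, rfl⟩
  refine isOpen_induced_iff.2 ⟨{f | dist (f x) (g x) < ε},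
    isOpen_lt (by fun_prop) continuous_const, ?_⟩
  ext ⟨_, k, hk, rfl⟩
  simp only [Set.mem_preimage, Set.mem_ofPred_eq, Set.mem_singleton_iff]
  constructor
  · intro hd
    have : g⁻¹ * k = 1 := by
      refine h _ (G.mul_mem (G.inv_mem hg) hk) ?_
      have e : (g⁻¹ * k) x = g.symm (k x) := rfl
      rw [e, ← g.dist_eq, g.apply_symm_apply]
      exact hd
    rw [inv_mul_eq_one] at this
    subst this
    rfl
  · intro he
    have := congrFun (congrArg Subtype.val he) x
    simp only at this
    rw [this, dist_self]
    exact hε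

/-- Bounded displacement at `x` confines the values on the finite test set to a compact product of
balls. Cover it by balls of radius `ε / 2`: two elements with values in the same ball are equal. -/
theorem IsDiscreteIsomSubgroup.finite_displacement_le (hG : IsDiscreteIsomSubgroup G)
    (x : Euc n) (R : ℝ) : {g | g ∈ G ∧ dist (g x) x ≤ R}.Finite := by
  classical
  obtain ⟨s, ε, hε, h⟩ := hG.exists_finset
  have hdist : ∀ g : EucIsom n, dist (g x) x ≤ R → ∀ y, g y ∈ Metric.closedBall x (dist y x + R) :=
    fun g hg y => (dist_triangle (g y) (g x) x).trans (by rw [g.dist_eq]; linarith)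
  let Φ : EucIsom n → (s → Euc n) := fun g y => g y
  let K : Set (s → Euc n) := Set.pi Set.univ fun y => Metric.closedBall x (dist (y : Euc n) x + R)
  have hK : IsCompact K := isCompact_univ_pi fun y => isCompact_closedBall _ _
  obtain ⟨t, -, htf, ht⟩ := hK.finite_cover_balls (half_pos hε)
  -- Send `g` to the center of a chosen ball containing `Φ g`. The default value is never taken on
  -- the set in question, by `hdist`.
  refine Set.Finite.of_finite_fibers (f := fun g : EucIsom n =>
    if hg : Φ g ∈ K then (Set.mem_iUnion₂.1 (ht hg)).choose else fun _ => x) ?_ ?_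
  · refine (htf.insert (fun _ => x)).subset ?_
    rintro _ ⟨g, -, rfl⟩
    dsimp only
    split_ifs with hg
    · exact Or.inr (Set.mem_iUnion₂.1 (ht hg)).choose_spec.choose
    · exact Or.inl rfl
  · intro c _
    refine Set.Subsingleton.finite ?_
    rintro g ⟨⟨hgG, hgR⟩, hgc⟩ k ⟨⟨hkG, hkR⟩, hkc⟩
    have key : ∀ g : EucIsom n, dist (g x) x ≤ R → (if hg : Φ g ∈ K then
        (Set.mem_iUnion₂.1 (ht hg)).choose else fun _ => x) = c → dist (Φ g) c < ε / 2 := by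
      intro g hgR hgc
      have hg : Φ g ∈ K := fun y _ => hdist g hgR y
      rw [dif_pos hg] at hgc
      rw [← hgc]
      exact (Set.mem_iUnion₂.1 (ht hg)).choose_spec.choose_spec
    have h1 := key g hgR hgc
    have h2 := key k hkR hkc
    have h3 : dist (Φ g) (Φ k) < ε := by
      have := dist_triangle_right (Φ g) (Φ k) c
      linarith
    have : k⁻¹ * g = 1 := by
      refine h _ (G.mul_mem (G.inv_mem hkG) hgG) fun y hy => ?_
      have e : (k⁻¹ * g) y = k.symm (g y) := rfl
      rw [e, ← k.dist_eq, k.apply_symm_apply]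
      exact (dist_le_pi_dist (Φ g) (Φ k) ⟨y, hy⟩).trans_lt h3
    rw [inv_mul_eq_one] at this
    exact this.symm

/-- Only finitely many nontrivial elements move `x` by at most 1; freeness makes their least
displacement positive. -/
theorem IsDiscreteIsomSubgroup.exists_displacement (hG : IsDiscreteIsomSubgroup G)
    (hfree : ∀ g ∈ G, ∀ x : Euc n, g x = x → g = 1) (x : Euc n) :
    ∃ ε : ℝ, 0 < ε ∧ ∀ g ∈ G, dist (g x) x < ε → g = 1 := by
  classical
  have hfin := hG.finite_displacement_le x 1
  have hfin' : {g | (g ∈ G ∧ dist (g x) x ≤ 1) ∧ g ≠ 1}.Finite := hfin.subset fun g h => h.1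
  rcases Set.eq_empty_or_nonempty {g | (g ∈ G ∧ dist (g x) x ≤ 1) ∧ g ≠ 1} with he | hne
  · refine ⟨1, one_pos, fun g hg hd => ?_⟩
    by_contra h1
    exact (Set.eq_empty_iff_forall_notMem.1 he g) ⟨⟨hg, hd.le⟩, h1⟩
  · obtain ⟨k, hk, hmin⟩ := Set.exists_min_image _ (fun g : EucIsom n => dist (g x) x) hfin' hne
    have hpos : 0 < dist (k x) x := dist_pos.2 fun h => hk.2 (hfree k hk.1.1 x h)
    refine ⟨min 1 (dist (k x) x), lt_min one_pos hpos, fun g hg hd => ?_⟩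
    by_contra h1
    have := hmin g ⟨⟨hg, (hd.trans_le (min_le_left _ _)).le⟩, h1⟩
    exact absurd (hd.trans_le (min_le_right _ _)) (not_lt.2 this)

end Discreteness

/-! ### The orbit metric and cocompactness -/

section OrbitSpace

variable {n : ℕ} {G : Subgroup (EucIsom n)}

theorem EucOrbitSpace.mk_eq_mk {a b : Euc n} :
    (Quotient.mk _ a : EucOrbitSpace G) = Quotient.mk _ b ↔ ∃ g ∈ G, g b = a := by
  rw [Quotient.eq, MulAction.orbitRel_apply]
  constructor
  · rintro ⟨g, hg⟩
    exact ⟨g, g.2, hg⟩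
  · rintro ⟨g, hg, h⟩
    exact ⟨⟨g, hg⟩, h⟩

theorem orbitDist_mk_le (a b : Euc n) :
    orbitDist (Quotient.mk _ a : EucOrbitSpace G) (Quotient.mk _ b) ≤ dist a b := by
  refine csInf_le ⟨0, ?_⟩ ⟨a, b, rfl, rfl, rfl⟩
  rintro _ ⟨a, b, -, -, rfl⟩
  exact dist_nonneg

theorem orbitDist_mk_lt_iff (a : Euc n) (z : EucOrbitSpace G) (r : ℝ) :
    orbitDist (Quotient.mk _ a : EucOrbitSpace G) z < r ↔
      ∃ b, dist a b < r ∧ (Quotient.mk _ b : EucOrbitSpace G) = z := by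
  constructor
  · intro h
    obtain ⟨z, rfl⟩ := Quotient.exists_rep z
    obtain ⟨_, ⟨a', b', ha, hb, rfl⟩, hd⟩ := exists_lt_of_csInf_lt (by exact ⟨_, a, z, rfl, rfl, rfl⟩) h
    obtain ⟨g, hg, rfl⟩ := EucOrbitSpace.mk_eq_mk.1 ha
    refine ⟨g.symm b', ?_, ?_⟩
    · rwa [← g.dist_eq, g.apply_symm_apply]
    · rw [← hb]
      exact EucOrbitSpace.mk_eq_mk.2 ⟨g⁻¹, G.inv_mem hg, rfl⟩
  · rintro ⟨b, hd, rfl⟩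
    exact (orbitDist_mk_le a b).trans_lt hd

theorem exists_dist_orbit_le_of_compact (h : CompactSpace (EucOrbitSpace G)) :
    ∃ R : ℝ, ∀ x : Euc n, ∃ g ∈ G, dist (g x) 0 ≤ R := by
  have hopen : IsOpenMap (Quotient.mk _ : Euc n → EucOrbitSpace G) := by
    have : ContinuousConstSMul G (Euc n) := ⟨fun g => g.1.continuous⟩
    exact isOpenMap_quotient_mk'_mul
  obtain ⟨t, ht⟩ := isCompact_univ.elim_finite_subcover
    (fun k : ℕ => (Quotient.mk _ : Euc n → EucOrbitSpace G) '' Metric.ball 0 k)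
    (fun k => hopen _ Metric.isOpen_ball) (by
      intro z _
      obtain ⟨z, rfl⟩ := Quotient.exists_rep z
      obtain ⟨k, hk⟩ := exists_nat_gt (dist z 0)
      exact Set.mem_iUnion.2 ⟨k, z, hk, rfl⟩)
  refine ⟨(t.sup id : ℕ), fun x => ?_⟩
  obtain ⟨k, hk, y, hy, hyx⟩ := Set.mem_iUnion₂.1 (ht (Set.mem_univ (Quotient.mk _ x)))
  obtain ⟨g, hg, rfl⟩ := EucOrbitSpace.mk_eq_mk.1 hyx
  refine ⟨g, hg, (Metric.mem_ball.1 hy).le.trans ?_⟩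
  exact_mod_cast Finset.le_sup (f := id) hk

theorem compactSpace_orbitSpace_of_dist_le (R : ℝ)
    (h : ∀ x : Euc n, ∃ g ∈ G, dist (g x) 0 ≤ R) : CompactSpace (EucOrbitSpace G) := by
  refine ⟨?_⟩
  have : (Set.univ : Set (EucOrbitSpace G)) = (Quotient.mk _) '' Metric.closedBall 0 R := by
    refine (Set.eq_univ_of_forall fun z => ?_).symm
    obtain ⟨z, rfl⟩ := Quotient.exists_rep z
    obtain ⟨g, hg, hd⟩ := h z
    exact ⟨g z, hd, EucOrbitSpace.mk_eq_mk.2 ⟨g, hg, rfl⟩⟩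
  rw [this]
  exact (isCompact_closedBall _ _).image continuous_quotient_mk'

end OrbitSpace

/-! ### The universal covering of a space form -/

namespace EuclideanSpaceForm

variable (M : EuclideanSpaceForm)

/-- The universal covering map `ℝⁿ → ℝⁿ/G`. -/
noncomputable def proj : Euc M.dim → M.Carrier := Quotient.mk _

variable {M}

theorem proj_eq_proj {a b : Euc M.dim} : M.proj a = M.proj b ↔ ∃ g ∈ M.group, g b = a :=
  EucOrbitSpace.mk_eq_mk

theorem proj_apply_mem {g : EucIsom M.dim} (hg : g ∈ M.group) (a : Euc M.dim) :
    M.proj (g a) = M.proj a := proj_eq_proj.2 ⟨g, hg, rfl⟩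

theorem eq_of_apply_eq {g h : EucIsom M.dim} (hg : g ∈ M.group) (hh : h ∈ M.group)
    {x : Euc M.dim} (e : g x = h x) : g = h := by
  have : h⁻¹ * g = 1 := M.free _ (M.group.mul_mem (M.group.inv_mem hh) hg) x (by
    change h.symm (g x) = x
    rw [e, h.symm_apply_apply])
  rw [inv_mul_eq_one] at this
  exact this.symm

variable (M)

theorem proj_surjective : Function.Surjective M.proj := Quotient.exists_rep

theorem exists_displacement (x : Euc M.dim) :
    ∃ ε : ℝ, 0 < ε ∧ ∀ g ∈ M.group, dist (g x) x < ε → g = 1 :=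
  M.discrete.exists_displacement M.free x

theorem isQuotientCoveringMap : IsQuotientCoveringMap M.proj M.group where
  __ := (isQuotientMap_quotient_mk' : Topology.IsQuotientMap M.proj)
  continuous_const_smul g := g.1.continuous
  apply_eq_iff_mem_orbit := proj_eq_proj.trans
    ⟨fun ⟨g, hg, h⟩ => ⟨⟨g, hg⟩, h⟩, fun ⟨g, h⟩ => ⟨g, g.2, h⟩⟩
  disjoint x := by
    obtain ⟨ε, hε, h⟩ := M.exists_displacement x
    refine ⟨Metric.ball x (ε / 2), Metric.ball_mem_nhds _ (half_pos hε), ?_⟩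
    rintro ⟨g, hg⟩ ⟨_, ⟨y, hy, rfl⟩, hgy⟩
    refine Subtype.ext (h g hg ?_)
    have h1 : dist (g y) x < ε / 2 := hgy
    have h2 : dist (g x) (g y) < ε / 2 := by rw [g.dist_eq, dist_comm]; exact hy
    linarith [dist_triangle (g x) (g y) x]

theorem isCoveringMap : IsCoveringMap M.proj := M.isQuotientCoveringMap.isCoveringMap

theorem continuous_proj : Continuous M.proj := M.isCoveringMap.continuous

theorem isOpenMap_proj : IsOpenMap M.proj := M.isCoveringMap.isOpenMap

theorem nonempty_fundamentalGroup_mulEquiv (x : M.Carrier) :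
    Nonempty (FundamentalGroup M.Carrier x ≃* M.group) := by
  obtain ⟨e, he⟩ := M.proj_surjective x
  -- The covering gives the opposite of the deck group; inversion undoes this.
  exact ⟨(M.isQuotientCoveringMap.fundamentalGroupEquiv ⟨e, he⟩).trans
    (MulEquiv.inv' M.group).symm⟩

theorem exists_orbitDist_proj_eq (x : Euc M.dim) :
    ∃ ε : ℝ, 0 < ε ∧ ∀ a ∈ Metric.ball x ε, ∀ b ∈ Metric.ball x ε,
      orbitDist (M.proj a) (M.proj b) = dist a b := by
  obtain ⟨ε, hε, h⟩ := M.exists_displacement x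
  -- If translates `g a`, `k b` were closer than `a`, `b`, then `k⁻¹ * g` would move `x` by less
  -- than `ε/4 + ε/2 + ε/4`.
  refine ⟨ε / 4, by positivity, fun a ha b hb => ?_⟩
  rw [Metric.mem_ball] at ha hb
  refine le_antisymm (orbitDist_mk_le a b) (le_csInf ⟨_, a, b, rfl, rfl, rfl⟩ ?_)
  rintro _ ⟨a', b', ha', hb', rfl⟩
  obtain ⟨g, hg, rfl⟩ := EucOrbitSpace.mk_eq_mk.1 ha'
  obtain ⟨k, hk, rfl⟩ := EucOrbitSpace.mk_eq_mk.1 hb'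
  by_cases h1 : k⁻¹ * g = 1
  · rw [inv_mul_eq_one] at h1
    rw [h1, g.dist_eq]
  · by_contra hlt
    refine h1 (h _ (M.group.mul_mem (M.group.inv_mem hk) hg) ?_)
    have e : (k⁻¹ * g) x = k.symm (g x) := rfl
    rw [e, ← k.dist_eq, k.apply_symm_apply]
    have h2 : dist (g x) (g a) < ε / 4 := by rw [g.dist_eq, dist_comm]; exact ha
    have h3 : dist (k b) (k x) < ε / 4 := by rw [k.dist_eq]; exact hb
    have h4 : dist a b < ε / 2 := by linarith [dist_triangle_right a b x]
    linarith [dist_triangle4 (g x) (g a) (k b) (k x)]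

theorem metricBall_proj (w : Euc M.dim) (r : ℝ) :
    M.metricBall (M.proj w) r = M.proj '' Metric.ball w r := by
  ext z
  refine (orbitDist_mk_lt_iff w z r).trans ?_
  simp only [Set.mem_image, Metric.mem_ball, dist_comm w]
  rfl

theorem isOpen_metricBall (y : M.Carrier) (r : ℝ) : IsOpen (M.metricBall y r) := by
  obtain ⟨w, rfl⟩ := M.proj_surjective y
  rw [metricBall_proj]
  exact M.isOpenMap_proj _ Metric.isOpen_ball

theorem mem_metricBall_self (y : M.Carrier) {r : ℝ} (hr : 0 < r) : y ∈ M.metricBall y r := by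
  obtain ⟨w, rfl⟩ := M.proj_surjective y
  rw [metricBall_proj]
  exact ⟨w, Metric.mem_ball_self hr, rfl⟩

theorem exists_lift {A : Type*} [TopologicalSpace A] [SimplyConnectedSpace A]
    [LocallyPathConnectedSpace A] {f : A → M.Carrier} (hf : Continuous f) (a : A)
    (x : Euc M.dim) (hx : M.proj x = f a) :
    ∃ F : A → Euc M.dim, Continuous F ∧ F a = x ∧ ∀ b, M.proj (F b) = f b := by
  obtain ⟨F, ⟨h1, h2⟩, -⟩ := M.isCoveringMap.existsUnique_continuousMap_lifts ⟨f, hf⟩ a x hx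
  exact ⟨F, F.continuous, h1, congrFun h2⟩

variable {M}

theorem lift_unique {A : Type*} [TopologicalSpace A] [PreconnectedSpace A]
    {F F' : A → Euc M.dim} (hF : Continuous F) (hF' : Continuous F')
    (h : ∀ a, M.proj (F a) = M.proj (F' a)) (a : A) (ha : F a = F' a) : F = F' :=
  M.isCoveringMap.eq_of_comp_eq hF hF' (funext h) a ha

end EuclideanSpaceForm

/-! ### Local isometries of Euclidean spaces are affine -/

section LocallyAffine

/-- A map between real inner product spaces that preserves distances on a ball is affine there. -/
theorem exists_linearIsometry_of_dist_eq {E F : Type*} [NormedAddCommGroup E]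
    [InnerProductSpace ℝ E] [NormedAddCommGroup F] [InnerProductSpace ℝ F] {f : E → F} {x : E}
    {ε : ℝ} (hε : 0 < ε)
    (h : ∀ a ∈ Metric.ball x ε, ∀ b ∈ Metric.ball x ε, dist (f a) (f b) = dist a b) :
    ∃ T : E →ₗᵢ[ℝ] F, ∀ a ∈ Metric.ball x ε, f a = f x + T (a - x) := by
  let g : E → F := fun u => f (x + u) - f x
  have hmem : ∀ u : E, ‖u‖ < ε → x + u ∈ Metric.ball x ε := fun u hu => by
    simpa [Metric.mem_ball, dist_eq_norm] using hu
  have hnorm : ∀ u, ‖u‖ < ε → ‖g u‖ = ‖u‖ := fun u hu => by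
    have := h _ (hmem u hu) x (Metric.mem_ball_self hε)
    simpa [g, dist_eq_norm] using this
  have hsub : ∀ u v, ‖u‖ < ε → ‖v‖ < ε → ‖g u - g v‖ = ‖u - v‖ := fun u v hu hv => by
    have := h _ (hmem u hu) _ (hmem v hv)
    simpa [g, dist_eq_norm] using this
  have hinner : ∀ u v, ‖u‖ < ε → ‖v‖ < ε → inner ℝ (g u) (g v) = inner ℝ u v := by
    intro u v hu hv
    rw [real_inner_eq_norm_mul_self_add_norm_mul_self_sub_norm_sub_mul_self_div_two,
      real_inner_eq_norm_mul_self_add_norm_mul_self_sub_norm_sub_mul_self_div_two,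
      hnorm u hu, hnorm v hv, hsub u v hu hv]
  -- Scaling by `c u` brings any `u` into the ball, which extends `g` to the map `T` on all of `E`.
  -- It preserves inner products, so its linearity defects have norm zero; no continuity is needed.
  let c : E → ℝ := fun u => ε / (‖u‖ + 1)
  have hc0 : ∀ u, 0 < c u := fun u => by positivity
  have hc : ∀ u, ‖c u • u‖ < ε := fun u => by
    rw [norm_smul, Real.norm_of_nonneg (hc0 u).le, div_mul_eq_mul_div, div_lt_iff₀ (by positivity)]
    nlinarith
  let T : E → F := fun u => (c u)⁻¹ • g (c u • u)
  have hTT : ∀ u v, inner ℝ (T u) (T v) = inner ℝ u v := fun u v => by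
    have h1 := (hc0 u).ne'
    have h2 := (hc0 v).ne'
    simp only [T, real_inner_smul_left, real_inner_smul_right, hinner _ _ (hc u) (hc v)]
    field_simp
  have hTg : ∀ u v, ‖v‖ < ε → inner ℝ (T u) (g v) = inner ℝ u v := fun u v hv => by
    have h1 := (hc0 u).ne'
    simp only [T, real_inner_smul_left, hinner _ _ (hc u) hv]
    field_simp
  have hadd : ∀ u v, T (u + v) = T u + T v := fun u v => by
    rw [← sub_eq_zero, ← inner_self_eq_zero (𝕜 := ℝ)]
    simp only [inner_sub_left, inner_sub_right, inner_add_left, inner_add_right, hTT]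
    ring
  have hsmul : ∀ (r : ℝ) u, T (r • u) = r • T u := fun r u => by
    rw [← sub_eq_zero, ← inner_self_eq_zero (𝕜 := ℝ)]
    simp only [inner_sub_left, inner_sub_right, real_inner_smul_left, real_inner_smul_right, hTT]
    ring
  refine ⟨⟨⟨⟨T, hadd⟩, hsmul⟩, fun u => ?_⟩, fun a ha => ?_⟩
  · change ‖T u‖ = ‖u‖
    rw [norm_eq_sqrt_real_inner, hTT, norm_eq_sqrt_real_inner]
  · have hu : ‖a - x‖ < ε := by simpa [dist_eq_norm] using ha
    change f a = f x + T (a - x)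
    have : T (a - x) - g (a - x) = 0 := by
      rw [← inner_self_eq_zero (𝕜 := ℝ)]
      simp only [inner_sub_left, inner_sub_right, hTT, hTg _ _ hu, hinner _ _ hu hu,
        real_inner_comm (T (a - x))]
      ring
    rw [sub_eq_zero.1 this]
    simp [g]

/-- If the pair `(f₁, f₂)` preserves distances on a ball, then `f₂` is affine there. -/
theorem exists_continuousLinearMap_of_dist_sq_eq {E F₁ F₂ : Type*} [NormedAddCommGroup E]
    [InnerProductSpace ℝ E] [NormedAddCommGroup F₁] [InnerProductSpace ℝ F₁]
    [NormedAddCommGroup F₂] [InnerProductSpace ℝ F₂] {f₁ : E → F₁} {f₂ : E → F₂} {x : E}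
    {ε : ℝ} (hε : 0 < ε) (h : ∀ a ∈ Metric.ball x ε, ∀ b ∈ Metric.ball x ε,
      dist a b ^ 2 = dist (f₁ a) (f₁ b) ^ 2 + dist (f₂ a) (f₂ b) ^ 2) :
    ∃ T : E →L[ℝ] F₂, ∀ a ∈ Metric.ball x ε, f₂ a = f₂ x + T (a - x) := by
  obtain ⟨T, hT⟩ := exists_linearIsometry_of_dist_eq
    (f := fun a => (WithLp.toLp 2 (f₁ a, f₂ a) : WithLp 2 (F₁ × F₂))) hε (x := x) (by
      intro a ha b hb
      rw [WithLp.prod_dist_eq_of_L2]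
      exact (congrArg Real.sqrt (h a ha b hb).symm).trans (Real.sqrt_sq dist_nonneg))
  refine ⟨(WithLp.sndL 2 ℝ F₁ F₂).comp T.toContinuousLinearMap, fun a ha => ?_⟩
  exact congrArg (fun p : WithLp 2 (F₁ × F₂) => p.snd) (hT a ha)

/-- A map that is affine near every point is affine. -/
theorem exists_continuousLinearMap_of_locally_affine {E F : Type*} [NormedAddCommGroup E]
    [NormedSpace ℝ E] [NormedAddCommGroup F] [NormedSpace ℝ F] {f : E → F}
    (h : ∀ x, ∃ T : E →L[ℝ] F, ∀ᶠ a in 𝓝 x, f a = f x + T (a - x)) :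
    ∃ T : E →L[ℝ] F, ∀ x a, f a = f x + T (a - x) := by
  have hderiv : ∀ x (T : E →L[ℝ] F), (∀ᶠ a in 𝓝 x, f a = f x + T (a - x)) →
      ∀ᶠ y in 𝓝 x, HasFDerivAt f T y := by
    intro x T hT
    filter_upwards [hT.eventually_nhds] with y hy
    have : HasFDerivAt (fun a => f x + T (a - x)) T y := by
      simpa using ((T.hasFDerivAt (x := y - x)).comp y
        ((hasFDerivAt_id y).sub_const x)).const_add (f x)
    exact this.congr_of_eventuallyEq hy
  have hdiff : Differentiable ℝ f := fun x => by
    obtain ⟨T, hT⟩ := h x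
    exact (hderiv x T hT).self_of_nhds.differentiableAt
  -- The derivative is locally constant, hence constant by connectedness.
  have hlc : IsLocallyConstant (fderiv ℝ f) := by
    rw [IsLocallyConstant.iff_eventually_eq]
    intro x
    obtain ⟨T, hT⟩ := h x
    have := hderiv x T hT
    filter_upwards [this] with y hy
    rw [hy.fderiv, this.self_of_nhds.fderiv]
  refine ⟨fderiv ℝ f 0, fun x a => ?_⟩
  have hc : ∀ y, fderiv ℝ (fun z => f z - fderiv ℝ f 0 z) y = 0 := fun y => by
    rw [fderiv_fun_sub (hdiff y) (ContinuousLinearMap.differentiableAt _),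
      ContinuousLinearMap.fderiv, hlc.apply_eq_of_preconnectedSpace y 0, sub_self]
  have := is_const_of_fderiv_eq_zero (𝕜 := ℝ)
    (hdiff.sub (fderiv ℝ f 0).differentiable) hc a x
  rw [map_sub, ← sub_eq_zero]
  simp only [Pi.sub_apply] at this
  rw [← sub_eq_zero] at this
  rw [← this]
  abel

end LocallyAffine

/-! ### Translations, linear parts and torsion -/

section Translations

variable {n : ℕ}

/-- The vectors of the translations in a group of isometries. -/
def translationVectors (G : Subgroup (EucIsom n)) : Submodule ℤ (Euc n) :=
  AddSubgroup.toIntSubmodule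
    { carrier := {v | ∃ g ∈ G, ∀ x, g x = x + v}
      zero_mem' := ⟨1, G.one_mem, fun x => (add_zero x).symm⟩
      add_mem' := by
        rintro v w ⟨g, hg, hgv⟩ ⟨h, hh, hhw⟩
        refine ⟨h * g, G.mul_mem hh hg, fun x => ?_⟩
        change h (g x) = _
        rw [hgv, hhw, add_assoc]
      neg_mem' := by
        rintro v ⟨g, hg, hgv⟩
        refine ⟨g⁻¹, G.inv_mem hg, fun x => ?_⟩
        change g.symm x = _
        rw [g.symm_apply_eq, hgv]
        abel }

theorem mem_translationVectors {G : Subgroup (EucIsom n)} {v : Euc n} :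
    v ∈ translationVectors G ↔ ∃ g ∈ G, ∀ x, g x = x + v := Iff.rfl

theorem discreteTopology_translationVectors {G : Subgroup (EucIsom n)}
    (hG : IsDiscreteIsomSubgroup G) : DiscreteTopology (translationVectors G) := by
  obtain ⟨s, ε, hε, h⟩ := hG.exists_finset
  rw [discreteTopology_iff_isOpen_singleton_zero, Metric.isOpen_singleton_iff]
  refine ⟨ε, hε, ?_⟩
  rintro ⟨v, g, hg, hv⟩ hd
  have hvε : ‖v‖ < ε := by simpa [Subtype.dist_eq] using hd
  have : g = 1 := h g hg fun x _ => by simpa [hv] using hvε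
  subst this
  have := hv 0
  rw [zero_add] at this
  exact Subtype.ext this.symm

/-- A group of translations is isomorphic to the group of its vectors. -/
theorem nonempty_mulEquiv_translationVectors {G : Subgroup (EucIsom n)}
    (hG : ∀ g ∈ G, IsTranslation g) :
    Nonempty (Multiplicative (translationVectors G) ≃* G) := by
  have hex : ∀ v : translationVectors G, ∃ g : G, ∀ x, g.1 x = x + v := fun v =>
    let ⟨g, hg, h⟩ := v.2
    ⟨⟨g, hg⟩, h⟩
  choose t ht using hex
  refine ⟨MulEquiv.ofBijective (MonoidHom.mk' (fun v => t v.toAdd) fun v w => ?_) ⟨?_, ?_⟩⟩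
  · refine Subtype.ext (IsometryEquiv.ext fun x => ?_)
    change (t (v.toAdd + w.toAdd)).1 x = (t v.toAdd).1 ((t w.toAdd).1 x)
    rw [ht, ht, ht, Submodule.coe_add]
    abel
  · intro v w hvw
    have h1 : t v.toAdd = t w.toAdd := hvw
    have h2 := ht v.toAdd 0
    rw [h1, ht w.toAdd 0] at h2
    exact Multiplicative.toAdd.injective (Subtype.ext (add_left_cancel h2).symm)
  · rintro ⟨g, hg⟩
    obtain ⟨v, hv⟩ := hG g hg
    refine ⟨Multiplicative.ofAdd ⟨v, g, hg, hv⟩, Subtype.ext (IsometryEquiv.ext fun x => ?_)⟩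
    exact (ht ⟨v, g, hg, hv⟩ x).trans (hv x).symm

theorem nonempty_mulEquiv_of_discreteTopology (L : Submodule ℤ (Euc n)) [DiscreteTopology L] :
    Nonempty (Multiplicative (Fin (Module.finrank ℤ L) → ℤ) ≃* Multiplicative L) :=
  ⟨(Module.finBasis ℤ L).equivFun.symm.toAddEquiv.toMultiplicative⟩

end Translations

/-- This is the Mazur–Ulam theorem. -/
theorem IsometryEquiv.exists_apply_eq_linear {n : ℕ} (g : EucIsom n) :
    ∃ A : Euc n ≃ₗᵢ[ℝ] Euc n, ∀ x y, g y = g x + A (y - x) := by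
  refine ⟨g.toRealAffineIsometryEquiv.linearIsometryEquiv, fun x y => ?_⟩
  have := g.toRealAffineIsometryEquiv.map_vadd x (y - x)
  simp only [vadd_eq_add, sub_add_cancel] at this
  rw [add_comm]
  exact this

namespace EuclideanSpaceForm

/-- An element of finite order, being affine, fixes the barycenter of an orbit of its powers; this
contradicts freeness. -/
theorem not_isOfFinOrder (M : EuclideanSpaceForm) (g : M.group) (hg : g ≠ 1) :
    ¬ IsOfFinOrder g := by
  intro h
  obtain ⟨k, hk, hgk⟩ := isOfFinOrder_iff_pow_eq_one.1 h
  obtain ⟨A, hA⟩ := IsometryEquiv.exists_apply_eq_linear g.1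
  let a : ℕ → Euc M.dim := fun i => (g ^ i).1 0
  have hsucc : ∀ i, a (i + 1) = g.1 0 + A (a i) := fun i => by
    have e : a (i + 1) = g.1 (a i) := by
      simp only [a, pow_succ']
      rfl
    rw [e, hA 0, sub_zero]
  let c : Euc M.dim := (k : ℝ)⁻¹ • ∑ i ∈ Finset.range k, a i
  have hk' : (k : ℝ) ≠ 0 := by exact_mod_cast hk.ne'
  have hsum : ∑ i ∈ Finset.range k, a (i + 1) = ∑ i ∈ Finset.range k, a i := by
    have h1 := Finset.sum_range_succ a k
    rw [Finset.sum_range_succ'] at h1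
    have : a k = a 0 := by simp only [a, hgk, pow_zero]
    rw [this] at h1
    exact add_right_cancel h1
  have hc : g.1 c = c := by
    rw [hA 0, sub_zero]
    conv_rhs => rw [show c = (k : ℝ)⁻¹ • ∑ i ∈ Finset.range k, a i from rfl, ← hsum]
    simp only [hsucc, Finset.sum_add_distrib, Finset.sum_const, Finset.card_range, smul_add, c,
      map_smul, map_sum, ← Nat.cast_smul_eq_nsmul ℝ, smul_smul, inv_mul_cancel₀ hk', one_smul]
  exact hg (Subtype.ext (M.free _ g.2 c hc))

end EuclideanSpaceForm

/-! ### Lifting a geometric fibering to universal covers -/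

namespace EuclideanSpaceForm

variable {M B F : EuclideanSpaceForm}

theorem eq_of_proj_eq {x : Euc M.dim} {ε : ℝ}
    (h : ∀ a ∈ Metric.ball x ε, ∀ b ∈ Metric.ball x ε, orbitDist (M.proj a) (M.proj b) = dist a b)
    {a b : Euc M.dim} (ha : a ∈ Metric.ball x ε) (hb : b ∈ Metric.ball x ε)
    (hab : M.proj a = M.proj b) : a = b := by
  rw [← dist_eq_zero, ← h a ha b hb, hab, h b hb b hb, dist_self]

/-- A local trivialization of `η : M → B` over `U` that is a local isometry. -/
structure IsGeometricTrivialization (η : M.Carrier → B.Carrier) (U : Set B.Carrier)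
    (φ : (η ⁻¹' U) ≃ₜ F.Carrier × U) : Prop where
  isOpen : IsOpen U
  snd_apply : ∀ p, ((φ p).2 : B.Carrier) = η p
  isometric : ∀ p, ∃ W ∈ 𝓝 p, ∀ a b : η ⁻¹' U, a ∈ W → b ∈ W →
    orbitDist a.1 b.1 ^ 2 = orbitDist (φ a).1 (φ b).1 ^ 2 +
      orbitDist ((φ a).2 : B.Carrier) ((φ b).2 : B.Carrier) ^ 2

section Lift

variable {η : M.Carrier → B.Carrier} (hη : Continuous η) {f : Euc M.dim → Euc B.dim}
  (hf : Continuous f) (hlift : ∀ x, B.proj (f x) = η (M.proj x))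

include hη hf hlift in
-- The covering maps of `M` and `B` are isometric near `x` and `f x`, so two of the three orbit
-- distances become Euclidean. The fiber term stays in `F`, since no lift of the fiber coordinate is
-- chosen yet.
theorem IsGeometricTrivialization.exists_dist_sq_eq {U : Set B.Carrier}
    {φ : (η ⁻¹' U) ≃ₜ F.Carrier × U} (hφ : IsGeometricTrivialization η U φ) (x : Euc M.dim)
    (hx : M.proj x ∈ η ⁻¹' U) :
    ∃ ε : ℝ, 0 < ε ∧ ∃ hU : ∀ a ∈ Metric.ball x ε, M.proj a ∈ η ⁻¹' U,
      ∀ a (ha : a ∈ Metric.ball x ε) b (hb : b ∈ Metric.ball x ε),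
        dist a b ^ 2 = orbitDist (φ ⟨M.proj a, hU a ha⟩).1 (φ ⟨M.proj b, hU b hb⟩).1 ^ 2 +
          dist (f a) (f b) ^ 2 := by
  obtain ⟨W, hW, hWφ⟩ := hφ.isometric ⟨M.proj x, hx⟩
  obtain ⟨W', hW', hWW⟩ := mem_nhds_subtype _ _ _ |>.1 hW
  obtain ⟨ε₁, hε₁, h₁⟩ := M.exists_orbitDist_proj_eq x
  obtain ⟨ε₂, hε₂, h₂⟩ := B.exists_orbitDist_proj_eq (f x)
  have n1 : M.proj ⁻¹' W' ∈ 𝓝 x := M.continuous_proj.continuousAt.preimage_mem_nhds hW'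
  have n2 : M.proj ⁻¹' (η ⁻¹' U) ∈ 𝓝 x :=
    ((hφ.isOpen.preimage hη).preimage M.continuous_proj).mem_nhds hx
  have n3 : f ⁻¹' Metric.ball (f x) ε₂ ∈ 𝓝 x :=
    hf.continuousAt.preimage_mem_nhds (Metric.ball_mem_nhds _ hε₂)
  obtain ⟨ε, hε, h⟩ := Metric.mem_nhds_iff.1 (Filter.inter_mem (Filter.inter_mem n1 n2)
    (Filter.inter_mem n3 (Metric.ball_mem_nhds x hε₁)))
  refine ⟨ε, hε, fun a ha => (h ha).1.2, fun a ha b hb => ?_⟩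
  rw [← h₁ a (h ha).2.2 b (h hb).2.2, ← h₂ _ (h ha).2.1 _ (h hb).2.1,
    hWφ ⟨M.proj a, (h ha).1.2⟩ ⟨M.proj b, (h hb).1.2⟩ (hWW (h ha).1.1) (hWW (h hb).1.1),
    hφ.snd_apply, hφ.snd_apply, hlift, hlift]

variable (htriv : ∀ y : B.Carrier, ∃ (U : Set B.Carrier) (φ : (η ⁻¹' U) ≃ₜ F.Carrier × U),
  y ∈ U ∧ IsGeometricTrivialization η U φ)

include hη hf hlift htriv in
theorem exists_lift_affine :
    ∃ T : Euc M.dim →L[ℝ] Euc B.dim, ∀ x a, f a = f x + T (a - x) := by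
  refine exists_continuousLinearMap_of_locally_affine fun x => ?_
  obtain ⟨U, φ, hyU, hφ⟩ := htriv (η (M.proj x))
  obtain ⟨ε₁, hε₁, hU, h₁⟩ := hφ.exists_dist_sq_eq hη hf hlift x hyU
  obtain ⟨z, hz⟩ := F.proj_surjective (φ ⟨M.proj x, hyU⟩).1
  obtain ⟨ε₂, hε₂, h₂⟩ := F.exists_orbitDist_proj_eq z
  have hopen : IsOpen ((fun p => (φ p).1) ⁻¹' (F.proj '' Metric.ball z ε₂)) :=
    (F.isOpenMap_proj _ Metric.isOpen_ball).preimage (continuous_fst.comp φ.continuous)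
  obtain ⟨O, hO, hOeq⟩ := isOpen_induced_iff.1 hopen
  have hxO : M.proj x ∈ O := by
    have : (⟨M.proj x, hyU⟩ : η ⁻¹' U) ∈ Subtype.val ⁻¹' O := by
      rw [hOeq]
      exact ⟨z, Metric.mem_ball_self hε₂, hz⟩
    exact this
  obtain ⟨ε, hε, h⟩ := Metric.mem_nhds_iff.1 (Filter.inter_mem (Metric.ball_mem_nhds x hε₁)
    ((hO.preimage M.continuous_proj).mem_nhds hxO))
  -- Lift the fiber coordinate pointwise into a ball on which `F.proj` is isometric. Continuity of
  -- `w` is not required: the pair `(w, f)` preserves distances, which already makes `f` affine.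
  have hsel : ∀ a, ∃ w : Euc F.dim, ∀ ha : a ∈ Metric.ball x ε,
      w ∈ Metric.ball z ε₂ ∧ F.proj w = (φ ⟨M.proj a, hU a (h ha).1⟩).1 := by
    intro a
    by_cases ha : a ∈ Metric.ball x ε
    · have : (⟨M.proj a, hU a (h ha).1⟩ : η ⁻¹' U) ∈ Subtype.val ⁻¹' O := (h ha).2
      rw [hOeq] at this
      obtain ⟨w, hw, hwe⟩ := this
      exact ⟨w, fun _ => ⟨hw, hwe⟩⟩
    · exact ⟨z, fun h => absurd h ha⟩
  choose w hw using hsel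
  obtain ⟨T, hT⟩ := exists_continuousLinearMap_of_dist_sq_eq (f₁ := w) (f₂ := f) hε (x := x)
    (fun a ha b hb => by
      rw [h₁ a (h ha).1 b (h hb).1, ← (hw a ha).2, ← (hw b hb).2,
        h₂ _ (hw a ha).1 _ (hw b hb).1])
  exact ⟨T, Filter.eventually_of_mem (Metric.ball_mem_nhds x hε) hT⟩

include htriv in
theorem isOpenMap_of_trivializations (hη : Continuous η) : IsOpenMap η := by
  rw [isOpenMap_iff_nhds_le]
  intro p
  obtain ⟨U, φ, hyU, hφ⟩ := htriv (η p)
  have h1 : IsOpenMap (fun q : η ⁻¹' U => η q) := by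
    have : (fun q : η ⁻¹' U => η q) = Subtype.val ∘ Prod.snd ∘ φ :=
      funext fun q => (hφ.snd_apply q).symm
    rw [this]
    exact hφ.isOpen.isOpenMap_subtype_val.comp (isOpenMap_snd.comp φ.isOpenMap)
  have h2 := h1.nhds_le ⟨p, hyU⟩
  rw [← (hφ.isOpen.preimage hη).isOpenEmbedding_subtypeVal.map_nhds_eq ⟨p, hyU⟩, Filter.map_map]
  exact h2

include hη hf hlift htriv in
-- `η` is open, and near `f x` the covering `B.proj` is injective, so image points of `η` near `η
-- (M.proj x)` come from values of `f`.
theorem isOpen_range_lift : IsOpen (Set.range f) := by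
  rw [isOpen_iff_mem_nhds]
  rintro _ ⟨x, rfl⟩
  obtain ⟨ε, hε, h⟩ := B.exists_orbitDist_proj_eq (f x)
  have hopen : IsOpen (B.proj ⁻¹' (η '' (M.proj '' (f ⁻¹' Metric.ball (f x) ε)))) :=
    (isOpenMap_of_trivializations htriv hη _
      (M.isOpenMap_proj _ (Metric.isOpen_ball.preimage hf))).preimage B.continuous_proj
  have hx : f x ∈ B.proj ⁻¹' (η '' (M.proj '' (f ⁻¹' Metric.ball (f x) ε))) :=
    ⟨_, ⟨x, Metric.mem_ball_self hε, rfl⟩, (hlift x).symm⟩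
  filter_upwards [hopen.mem_nhds hx, Metric.ball_mem_nhds (f x) hε] with y hy hyb
  obtain ⟨_, ⟨a, ha, rfl⟩, hae⟩ := hy
  refine ⟨a, eq_of_proj_eq h ha hyb ?_⟩
  rw [hlift, hae]

include hη hf hlift htriv in
-- The linear part of the affine map `f` has a range with nonempty interior, and a proper subspace
-- has none.
theorem lift_surjective : Function.Surjective f := by
  obtain ⟨T, hT⟩ := exists_lift_affine hη hf hlift htriv
  have hopen := isOpen_range_lift hη hf hlift htriv
  have hr : ((T : Euc M.dim →ₗ[ℝ] Euc B.dim).range : Set (Euc B.dim)) =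
      (fun y => f 0 + y) ⁻¹' Set.range f := by
    ext y
    constructor
    · rintro ⟨a, rfl⟩
      exact ⟨a, by simpa using hT 0 a⟩
    · rintro ⟨a, ha⟩
      refine ⟨a, ?_⟩
      have := hT 0 a
      rw [ha, sub_zero] at this
      exact (add_left_cancel this).symm
  have htop : (T : Euc M.dim →ₗ[ℝ] Euc B.dim).range = ⊤ := by
    refine Submodule.eq_top_of_nonempty_interior' _ ⟨0, ?_⟩
    rw [hr, (hopen.preimage (by fun_prop)).interior_eq]
    exact ⟨0, (add_zero _).symm⟩
  intro y
  obtain ⟨a, ha⟩ := LinearMap.range_eq_top.1 htop (y - f 0)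
  refine ⟨a, ?_⟩
  rw [hT 0 a, sub_zero]
  have : T a = y - f 0 := ha
  rw [this, add_sub_cancel]

include hf hlift in
theorem exists_monoidHom_of_lift : ∃ θ : M.group →* B.group,
    ∀ (g : M.group) x, f (g.1 x) = (θ g).1 (f x) := by
  have hex : ∀ g : M.group, ∃ h : B.group, ∀ x, f (g.1 x) = h.1 (f x) := by
    intro g
    have hproj : ∀ x, B.proj (f (g.1 x)) = B.proj (f x) := fun x => by
      rw [hlift, hlift, proj_apply_mem g.2]
    obtain ⟨h, hh, h0⟩ := proj_eq_proj.1 (hproj 0)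
    refine ⟨⟨h, hh⟩, fun x => ?_⟩
    -- `f ∘ g` and `h ∘ f` lift the same map and agree at `0`.
    exact congrFun (lift_unique (M := B) (hf.comp g.1.continuous) (h.continuous.comp hf)
      (fun x => by
        simp only [Function.comp]
        rw [hproj, proj_apply_mem hh]) 0 h0.symm) x
  choose θ hθ using hex
  refine ⟨MonoidHom.mk' θ fun g k => ?_, hθ⟩
  refine Subtype.ext (eq_of_apply_eq (θ (g * k)).2 (θ g * θ k).2 (x := f 0) ?_)
  rw [← hθ]
  change f (g.1 (k.1 0)) = (θ g).1 ((θ k).1 (f 0))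
  rw [hθ, hθ]

include hη hf hlift htriv in
theorem monoidHom_of_lift_surjective {θ : M.group →* B.group}
    (hθ : ∀ (g : M.group) x, f (g.1 x) = (θ g).1 (f x)) : Function.Surjective θ := by
  intro h
  obtain ⟨x, hx⟩ := lift_surjective hη hf hlift htriv (h.1 (f 0))
  obtain ⟨U, φ, hyU, hφ⟩ := htriv (η (M.proj 0))
  have hηx : η (M.proj x) = η (M.proj 0) := by
    rw [← hlift, ← hlift, hx, proj_apply_mem h.2]
  have hxU : η (M.proj x) ∈ U := by rwa [hηx]
  obtain ⟨z, hz⟩ := F.proj_surjective (φ ⟨M.proj 0, hyU⟩).1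
  obtain ⟨w, hw⟩ := F.proj_surjective (φ ⟨M.proj x, hxU⟩).1
  -- `c` parametrizes the fiber of `η` through `M.proj 0`, which also contains `M.proj x`. Its lift
  -- `Λ` through `0` stays in one level set of `f` and ends at a `M.group`-translate of `x`; the
  -- translating element is the preimage of `h`.
  let c : Euc F.dim → M.Carrier := fun a => (φ.symm (F.proj a, ⟨η (M.proj 0), hyU⟩)).1
  have hc : Continuous c := continuous_subtype_val.comp
    (φ.symm.continuous.comp (F.continuous_proj.prodMk continuous_const))
  have hcη : ∀ a, η (c a) = η (M.proj 0) := fun a => by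
    rw [← hφ.snd_apply, φ.apply_symm_apply]
  have hcp : ∀ (a : Euc F.dim) (y : Euc M.dim) (hyU' : η (M.proj y) ∈ U),
      η (M.proj y) = η (M.proj 0) → F.proj a = (φ ⟨M.proj y, hyU'⟩).1 → c a = M.proj y := by
    intro a y hyU' hy ha
    have : φ.symm (F.proj a, ⟨η (M.proj 0), hyU⟩) = ⟨M.proj y, hyU'⟩ := by
      rw [φ.symm_apply_eq]
      exact Prod.ext ha (Subtype.ext (by rw [hφ.snd_apply]; exact hy.symm))
    exact congrArg Subtype.val this
  obtain ⟨Λ, hΛ, hΛz, hΛp⟩ := M.exists_lift hc z 0 (hcp z 0 hyU rfl hz).symm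
  have hconst : f ∘ Λ = fun _ => f 0 := lift_unique (M := B) (hf.comp hΛ) continuous_const
    (fun a => by rw [Function.comp, hlift, hΛp, hcη, hlift]) z (by rw [Function.comp, hΛz])
  have hpx : M.proj x = M.proj (Λ w) := by rw [hΛp, hcp w x hxU hηx hw]
  obtain ⟨g, hg, hgx⟩ := proj_eq_proj.1 hpx
  refine ⟨⟨g, hg⟩, Subtype.ext (eq_of_apply_eq (θ ⟨g, hg⟩).2 h.2 (x := f 0) ?_)⟩
  rw [← hx, ← hgx, hθ ⟨g, hg⟩, show f (Λ w) = f 0 from congrFun hconst w]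

include hη hf hlift htriv in
theorem isTranslation_of_lift_invariant (hF : F.IsFlatTorus) {g : EucIsom M.dim}
    (hg : g ∈ M.group) (hgf : ∀ x, f (g x) = f x) : IsTranslation g := by
  obtain ⟨T, hT⟩ := exists_lift_affine hη hf hlift htriv
  obtain ⟨U, φ, hyU, hφ⟩ := htriv (η (M.proj 0))
  -- `V` is the leaf of `f` through `0`; it projects into a single fiber of `η`.
  let V : Submodule ℝ (Euc M.dim) := (T : Euc M.dim →ₗ[ℝ] Euc B.dim).ker
  have hVf : ∀ v : V, f v = f 0 := fun v => by
    rw [hT 0, sub_zero, show T v = 0 from v.2, add_zero]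
  have hVU : ∀ v : V, M.proj v ∈ η ⁻¹' U := fun v => by
    rw [Set.mem_preimage, ← hlift, hVf, hlift]
    exact hyU
  let δ : V → F.Carrier := fun v => (φ ⟨M.proj v, hVU v⟩).1
  have hδ : Continuous δ := continuous_fst.comp (φ.continuous.comp
    ((M.continuous_proj.comp continuous_subtype_val).subtype_mk _))
  obtain ⟨z, hz⟩ := F.proj_surjective (δ 0)
  -- `D` develops the leaf into the universal cover of `F`. The base term vanishes on `V`, so `D` is
  -- a local isometry, hence affine with injective linear part `S`.
  obtain ⟨D, hD, -, hDδ⟩ := F.exists_lift hδ 0 z hz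
  have hloc : ∀ v : V, ∃ ε : ℝ, 0 < ε ∧
      ∀ a ∈ Metric.ball v ε, ∀ b ∈ Metric.ball v ε, dist (D a) (D b) = dist a b := by
    intro v
    obtain ⟨ε₁, hε₁, hU, h₁⟩ := hφ.exists_dist_sq_eq hη hf hlift v (hVU v)
    obtain ⟨ε₂, hε₂, h₂⟩ := F.exists_orbitDist_proj_eq (D v)
    obtain ⟨ε, hε, h⟩ := Metric.mem_nhds_iff.1 (Filter.inter_mem (Metric.ball_mem_nhds v hε₁)
      (hD.continuousAt.preimage_mem_nhds (Metric.ball_mem_nhds (D v) hε₂)))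
    refine ⟨ε, hε, fun a ha b hb => ?_⟩
    have := h₁ a (h ha).1 b (h hb).1
    rw [hVf, hVf, dist_self, zero_pow two_ne_zero, add_zero] at this
    rw [← h₂ _ (h ha).2 _ (h hb).2, hDδ, hDδ]
    have h0 : 0 ≤ orbitDist (δ a) (δ b) := by
      rw [← hDδ, ← hDδ, h₂ _ (h ha).2 _ (h hb).2]
      exact dist_nonneg
    exact ((sq_eq_sq₀ dist_nonneg h0).1 this).symm
  obtain ⟨S, hS⟩ := exists_continuousLinearMap_of_locally_affine (f := D) fun v => by
    obtain ⟨ε, hε, h⟩ := hloc v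
    obtain ⟨T, hT⟩ := exists_linearIsometry_of_dist_eq hε h
    exact ⟨T.toContinuousLinearMap, Filter.eventually_of_mem (Metric.ball_mem_nhds v hε) hT⟩
  have hSinj : ∀ v : V, S v = 0 → v = 0 := by
    intro v hv
    obtain ⟨ε, hε, h⟩ := hloc 0
    have hpos : 0 < ε / (‖v‖ + 1) := by positivity
    have hmem : (ε / (‖v‖ + 1)) • v ∈ Metric.ball (0 : V) ε := by
      rw [mem_ball_zero_iff, norm_smul, Real.norm_of_nonneg hpos.le, div_mul_eq_mul_div,
        div_lt_iff₀ (by positivity)]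
      nlinarith
    have := h _ hmem 0 (Metric.mem_ball_self hε)
    rw [hS 0, sub_zero, map_smul, hv, smul_zero, add_zero, dist_self] at this
    have := dist_eq_zero.1 this.symm
    exact (smul_eq_zero.1 this).resolve_left hpos.ne'
  have hgV : ∀ v : V, g v ∈ V := fun v => by
    have h1 := hT 0 (g v)
    rw [hgf, hVf, sub_zero] at h1
    exact left_eq_add.1 h1
  let g' : V → V := fun v => ⟨g v, hgV v⟩
  have hg' : Continuous g' := (g.continuous.comp continuous_subtype_val).subtype_mk _
  have hδg : ∀ v, δ (g' v) = δ v := fun v => by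
    have : (⟨M.proj (g v), hVU (g' v)⟩ : η ⁻¹' U) = ⟨M.proj v, hVU v⟩ :=
      Subtype.ext (proj_apply_mem hg v)
    exact congrArg (fun p => (φ p).1) this
  have hDg : ∀ v, F.proj (D (g' v)) = F.proj (D v) := fun v => by rw [hDδ, hDδ, hδg]
  obtain ⟨k, hk, hk0⟩ := proj_eq_proj.1 (hDg 0)
  -- Only here is the fiber required to be a torus: the deck transformation `k` induced by `g` is a
  -- translation.
  obtain ⟨L, _, -, hL⟩ := hF
  obtain ⟨l, -, hl⟩ := (hL k).1 hk
  have hDl : ∀ v, D (g' v) = D v + l := fun v => by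
    rw [← hl]
    exact congrFun (lift_unique (M := F) (hD.comp hg') (k.continuous.comp hD)
      (fun v => by
        simp only [Function.comp]
        rw [hDg, proj_apply_mem hk]) 0 hk0.symm) v
  obtain ⟨A, hA⟩ := IsometryEquiv.exists_apply_eq_linear g
  -- Through `D` the map `g` on `V` becomes a translation; injectivity of `S` carries this back to
  -- `V`.
  have hAV : ∀ v : V, A v = v := by
    intro v
    have h1 : S (g' v - g' 0 - v) = 0 := by
      have e1 := hS (g' 0) (g' v)
      have e2 := hS 0 v
      rw [hDl, hDl, e2, sub_zero, add_right_comm] at e1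
      rw [map_sub, sub_eq_zero]
      exact (add_left_cancel e1).symm
    have h2 := congrArg Subtype.val (hSinj _ h1)
    have h3 : g v - g 0 - v = 0 := h2
    rw [hA 0, sub_zero, add_sub_cancel_left] at h3
    exact sub_eq_zero.1 h3
  -- Comparing linear parts in `f ∘ g = f`.
  have hTA : ∀ u, T (A u - u) = 0 := by
    intro u
    have e1 := hT (g 0) (g u)
    have e2 := hT 0 u
    rw [hgf, hgf, e2, hA 0 u, add_sub_cancel_left, sub_zero] at e1
    rw [map_sub, sub_eq_zero]
    exact (add_left_cancel e1).symm
  refine ⟨g 0, fun x => ?_⟩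
  rw [hA 0 x, sub_zero, add_comm]
  congr 1
  -- `A` fixes `A x - x ∈ V`, so that vector has the same inner product with `A x` as with `x`.
  have hw := hAV ⟨A x - x, hTA x⟩
  simp only at hw
  rw [← sub_eq_zero, ← inner_self_eq_zero (𝕜 := ℝ)]
  calc inner ℝ (A x - x) (A x - x)
      = inner ℝ (A (A x - x)) (A x) - inner ℝ (A x - x) x := by rw [hw, ← inner_sub_right]
    _ = 0 := by rw [A.inner_map_map, sub_self]

end Lift

/-- The fundamental groups of the total space and the base of a geometric fibering with flat torus
fiber form an extension whose kernel consists of translations. -/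
theorem GeometricallyFibers.exists_monoidHom (h : M.GeometricallyFibers B F)
    (hF : F.IsFlatTorus) : ∃ θ : M.group →* B.group, Function.Surjective θ ∧
      ∀ g, θ g = 1 → IsTranslation g.1 := by
  obtain ⟨η, hη, -, htriv⟩ := h
  have htriv' : ∀ y : B.Carrier, ∃ (U : Set B.Carrier) (φ : (η ⁻¹' U) ≃ₜ F.Carrier × U),
      y ∈ U ∧ IsGeometricTrivialization η U φ := fun y => by
    obtain ⟨r, hr, φ, h1, h2⟩ := htriv y
    exact ⟨_, φ, B.mem_metricBall_self y hr, B.isOpen_metricBall y r, h1, h2⟩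
  obtain ⟨y, hy⟩ := B.proj_surjective (η (M.proj 0))
  obtain ⟨f, hf, -, hlift⟩ := B.exists_lift (hη.comp M.continuous_proj) 0 y hy
  obtain ⟨θ, hθ⟩ := exists_monoidHom_of_lift hf hlift
  refine ⟨θ, monoidHom_of_lift_surjective hη hf hlift htriv' hθ, fun g hg => ?_⟩
  refine isTranslation_of_lift_invariant hη hf hlift htriv' hF g.2 fun x => ?_
  rw [hθ, hg]
  rfl

end EuclideanSpaceForm

/-! ### From iterated torus bundles to the class `𝒵` -/

theorem IsDiscreteIsomSubgroup.mono {n : ℕ} {G H : Subgroup (EucIsom n)}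
    (hG : IsDiscreteIsomSubgroup G) (h : H ≤ G) : IsDiscreteIsomSubgroup H := by
  unfold IsDiscreteIsomSubgroup at hG ⊢
  exact DiscreteTopology.of_subset hG (Set.image_mono h)

namespace EuclideanSpaceForm

theorem isClassZ_zero_of_isFlatTorus {E : EuclideanSpaceForm} (hdim : 0 < E.dim)
    (hE : E.IsFlatTorus) {Γ : Type u} [Group Γ] (e : E.group ≃* Γ) : IsClassZ 0 Γ := by
  obtain ⟨L, _, hL, hLG⟩ := hE
  constructor
  · by_contra hn
    rw [not_nontrivial_iff_subsingleton] at hn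
    have : Subsingleton E.group := e.toEquiv.subsingleton
    have hbot : Submodule.span ℝ (L : Set (Euc E.dim)) = ⊥ := by
      rw [Submodule.span_eq_bot]
      intro v hv
      have hg : IsometryEquiv.addRight v ∈ E.group := (hLG _).2 ⟨v, hv, fun _ => rfl⟩
      have h1 : (⟨_, hg⟩ : E.group) = 1 := Subsingleton.elim _ _
      have h2 := congrArg (fun g : E.group => g.1 0) h1
      have h3 : (0 : Euc E.dim) + v = 0 := h2
      rwa [zero_add] at h3
    rw [hL.span_top] at hbot
    have : Nonempty (Fin E.dim) := ⟨⟨0, hdim⟩⟩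
    exact top_ne_bot hbot
  · have := discreteTopology_translationVectors E.discrete
    obtain ⟨e₁⟩ := nonempty_mulEquiv_translationVectors (G := E.group) fun g hg =>
      let ⟨v, _, h⟩ := (hLG g).1 hg
      ⟨v, h⟩
    obtain ⟨e₂⟩ := nonempty_mulEquiv_of_discreteTopology (translationVectors E.group)
    exact ⟨_, ⟨((e₂.trans e₁).trans e).symm⟩⟩

theorem isClassZ_of_isIteratedTorusBundle : ∀ (i : ℕ) (E : EuclideanSpaceForm),
    E.IsIteratedTorusBundle i → ∀ (Γ : Type u) [Group Γ], (E.group ≃* Γ) → IsClassZ i Γ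
  | 0, E, hE, Γ, _, e => isClassZ_zero_of_isFlatTorus hE.1 hE.2 e
  | i + 1, E, ⟨B, F, hB, hF, hfib⟩, Γ, _, e => by
    obtain ⟨θ, hθ, hker⟩ := hfib.exists_monoidHom hF
    have hrange : (E.group.subtype.comp e.symm.toMonoidHom).range = E.group := by
      ext g
      constructor
      · rintro ⟨γ, rfl⟩
        exact (e.symm γ).2
      · intro hg
        exact ⟨e ⟨g, hg⟩, congrArg Subtype.val (e.symm_apply_apply _)⟩
    refine ⟨fun g hg hfin => ?_, E.dim, E.group.subtype.comp e.symm.toMonoidHom, ?_, ?_⟩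
    · refine E.not_isOfFinOrder (e.symm g) ?_ (e.symm.toMonoidHom.isOfFinOrder hfin)
      simpa using hg
    · exact ⟨Subtype.val_injective.comp e.symm.injective, by rw [hrange]; exact E.discrete,
        by rw [hrange]; exact E.compact⟩
    · let K : Subgroup (EucIsom E.dim) := θ.ker.map E.group.subtype
      have hK : K ≤ E.group := by
        rintro _ ⟨g, -, rfl⟩
        exact g.2
      have hKt : ∀ g ∈ K, IsTranslation g := by
        rintro _ ⟨g, hg, rfl⟩
        exact hker g hg
      have := discreteTopology_translationVectors (E.discrete.mono hK)
      obtain ⟨e₁⟩ := nonempty_mulEquiv_translationVectors hKt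
      obtain ⟨e₂⟩ := nonempty_mulEquiv_of_discreteTopology (translationVectors K)
      -- `B.group` lives in `Type`, while the quotient in `IsClassZ` must live in `Type u`.
      let up : B.group ≃* ULift.{u} B.group := MulEquiv.ulift.symm
      refine ⟨_, ULift.{u} B.group, inferInstance,
        (e.toMonoidHom.comp (Subgroup.inclusion hK)).comp (e₂.trans e₁).toMonoidHom,
        (up.toMonoidHom.comp θ).comp e.symm.toMonoidHom,
        (e.injective.comp (Subgroup.inclusion_injective hK)).comp (e₂.trans e₁).injective,
        (up.surjective.comp hθ).comp e.symm.surjective, ?_,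
        isClassZ_of_isIteratedTorusBundle i B hB _ up, fun z => ?_⟩
      · ext γ
        have hmem : γ ∈ ((up.toMonoidHom.comp θ).comp e.symm.toMonoidHom :
            Γ →* ULift.{u} B.group).ker ↔ θ (e.symm γ) = 1 := by
          rw [MonoidHom.mem_ker]
          exact up.map_eq_one_iff
        rw [hmem]
        constructor
        · rintro ⟨z, rfl⟩
          obtain ⟨g, hg, hgz⟩ := (e₂.trans e₁ z).2
          have : e.symm (e (Subgroup.inclusion hK (e₂.trans e₁ z))) = g := by
            rw [e.symm_apply_apply]
            exact Subtype.ext hgz.symm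
          exact (congrArg θ this).trans hg
        · intro h
          refine ⟨(e₂.trans e₁).symm ⟨(e.symm γ).1, e.symm γ, h, rfl⟩, ?_⟩
          change e (Subgroup.inclusion hK (e₂.trans e₁ ((e₂.trans e₁).symm _))) = γ
          rw [MulEquiv.apply_symm_apply]
          exact e.apply_symm_apply γ
      · obtain ⟨v, hv⟩ := hKt _ (e₂.trans e₁ z).2
        refine ⟨v, fun x => ?_⟩
        rw [← hv]
        change (e.symm (e (Subgroup.inclusion hK (e₂.trans e₁ z)))).1 x = _
        rw [e.symm_apply_apply]
        rfl

end EuclideanSpaceForm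

/-! ### Tools for constructing space forms -/

section IsometricAction

/-- An action by isometries, as a homomorphism to the isometry group. -/
def isometricAction {Γ X : Type*} [Group Γ] [PseudoEMetricSpace X] (f : Γ → X → X)
    (h1 : ∀ x, f 1 x = x) (hmul : ∀ a b x, f (a * b) x = f a (f b x))
    (hiso : ∀ a, Isometry (f a)) : Γ →* (X ≃ᵢ X) where
  toFun a := ⟨⟨f a, f a⁻¹, fun x => by rw [← hmul, inv_mul_cancel, h1],
    fun x => by rw [← hmul, mul_inv_cancel, h1]⟩, hiso a⟩
  map_one' := IsometryEquiv.ext h1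
  map_mul' a b := IsometryEquiv.ext (hmul a b)

end IsometricAction

theorem exists_homeomorph_of_isQuotientMap {X Y Z : Type*} [TopologicalSpace X]
    [TopologicalSpace Y] [TopologicalSpace Z] {f : X → Y} {g : X → Z}
    (hf : Topology.IsQuotientMap f) (hg : Topology.IsQuotientMap g)
    (h : ∀ a b, f a = f b ↔ g a = g b) : ∃ φ : Y ≃ₜ Z, ∀ x, φ (f x) = g x := by
  let F : C(X, Y) := ⟨f, hf.continuous⟩
  let G : C(X, Z) := ⟨g, hg.continuous⟩
  have hF : Topology.IsQuotientMap F := hf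
  have hG : Topology.IsQuotientMap G := hg
  let u : C(Y, Z) := hF.lift G fun a b hab => (h a b).1 hab
  let v : C(Z, Y) := hG.lift F fun a b hab => (h a b).2 hab
  have hu : ∀ x, u (f x) = g x := DFunLike.congr_fun (hF.lift_comp G fun a b hab => (h a b).1 hab)
  have hv : ∀ x, v (g x) = f x := DFunLike.congr_fun (hG.lift_comp F fun a b hab => (h a b).2 hab)
  refine ⟨⟨⟨u, v, fun y => ?_, fun z => ?_⟩, u.continuous, v.continuous⟩, hu⟩
  · obtain ⟨x, rfl⟩ := hf.surjective y
    rw [hu, hv]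
  · obtain ⟨x, rfl⟩ := hg.surjective z
    rw [hv, hu]

/-- Subtracting the integral part in a lattice basis moves any vector into the bounded fundamental
parallelepiped. -/
theorem exists_norm_add_le_of_isZLattice {E : Type*} [NormedAddCommGroup E] [NormedSpace ℝ E]
    [FiniteDimensional ℝ E] (L : Submodule ℤ E) [DiscreteTopology L] [IsZLattice ℝ L] :
    ∃ R : ℝ, ∀ x : E, ∃ v ∈ L, ‖x + v‖ ≤ R := by
  let b := (Module.Free.chooseBasis ℤ L).ofZLatticeBasis ℝ L
  refine ⟨∑ i, ‖b i‖, fun x => ⟨-(ZSpan.floor b x : E), ?_, ?_⟩⟩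
  · have h : (ZSpan.floor b x : E) ∈ Submodule.span ℤ (Set.range b) := (ZSpan.floor b x).2
    exact L.neg_mem ((Module.Basis.ofZLatticeBasis_span ℝ L _).le h)
  · have := ZSpan.norm_fract_le b x
    rwa [ZSpan.fract_apply, sub_eq_add_neg] at this

theorem exists_norm_lt_of_discreteTopology {E : Type*} [NormedAddCommGroup E] (L : Submodule ℤ E)
    [DiscreteTopology L] : ∃ ε : ℝ, 0 < ε ∧ ∀ v ∈ L, ‖v‖ < ε → v = 0 := by
  obtain ⟨ε, hε, h⟩ := Metric.isOpen_singleton_iff.1 (isOpen_discrete ({0} : Set L))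
  refine ⟨ε, hε, fun v hv hvε => congrArg Subtype.val (h ⟨v, hv⟩ ?_)⟩
  simpa [Subtype.dist_eq] using hvε

/-! ### Flat tori -/

section Torus

variable {k : ℕ}

/-- The homomorphism sending a vector to the translation by it. -/
noncomputable def translationHom (k : ℕ) : Multiplicative (Euc k) →* EucIsom k where
  toFun v := IsometryEquiv.addRight v.toAdd
  map_one' := IsometryEquiv.ext fun x => add_zero x
  map_mul' v w := IsometryEquiv.ext fun x => by
    change x + (v.toAdd + w.toAdd) = x + w.toAdd + v.toAdd
    abel

/-- The group of translations by the vectors of `L`. -/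
noncomputable def translationSubgroup (L : Submodule ℤ (Euc k)) : Subgroup (EucIsom k) :=
  L.toAddSubgroup.toSubgroup.map (translationHom k)

theorem mem_translationSubgroup {L : Submodule ℤ (Euc k)} {g : EucIsom k} :
    g ∈ translationSubgroup L ↔ ∃ v ∈ L, ∀ x, g x = x + v := by
  constructor
  · rintro ⟨v, hv, rfl⟩
    exact ⟨v.toAdd, hv, fun _ => rfl⟩
  · rintro ⟨v, hv, h⟩
    exact ⟨Multiplicative.ofAdd v, hv, IsometryEquiv.ext fun x => (h x).symm⟩

namespace EuclideanSpaceForm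

/-- The flat torus `ℝᵏ/L`. -/
noncomputable def torus (L : Submodule ℤ (Euc k)) [DiscreteTopology L] [IsZLattice ℝ L] :
    EuclideanSpaceForm where
  dim := k
  group := translationSubgroup L
  discrete := by
    obtain ⟨ε, hε, h⟩ := exists_norm_lt_of_discreteTopology L
    refine IsDiscreteIsomSubgroup.of_displacement 0 ε hε fun g hg hd => ?_
    obtain ⟨v, hv, hgv⟩ := mem_translationSubgroup.1 hg
    rw [hgv, zero_add, dist_zero_right] at hd
    ext1 x
    rw [hgv, h v hv hd, add_zero]
    rfl
  free g hg x hx := by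
    obtain ⟨v, hv, hgv⟩ := mem_translationSubgroup.1 hg
    rw [hgv, add_eq_left] at hx
    ext1 y
    rw [hgv, hx, add_zero]
    rfl
  compact := by
    obtain ⟨R, hR⟩ := exists_norm_add_le_of_isZLattice L
    refine compactSpace_orbitSpace_of_dist_le R fun x => ?_
    obtain ⟨v, hv, h⟩ := hR x
    exact ⟨IsometryEquiv.addRight v, mem_translationSubgroup.2 ⟨v, hv, fun _ => rfl⟩,
      by rwa [dist_zero_right]⟩

theorem isFlatTorus_torus (L : Submodule ℤ (Euc k)) [DiscreteTopology L] [IsZLattice ℝ L] :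
    (torus L).IsFlatTorus :=
  ⟨L, inferInstanceAs (DiscreteTopology L), inferInstanceAs (IsZLattice ℝ L),
    fun _ => mem_translationSubgroup⟩

theorem exists_torus_of_isClassZ_zero {Γ : Type u} [Group Γ] (h : IsClassZ 0 Γ) :
    ∃ E : EuclideanSpaceForm, E.IsIteratedTorusBundle 0 ∧ Nonempty (E.group ≃* Γ) := by
  obtain ⟨hn, k, ⟨e⟩⟩ := h
  have hk : 0 < k := by
    rw [Nat.pos_iff_ne_zero]
    rintro rfl
    have : Subsingleton Γ := e.toEquiv.subsingleton
    exact not_subsingleton Γ this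
  let b := (EuclideanSpace.basisFun (Fin k) ℝ).toBasis
  let L : Submodule ℤ (Euc k) := Submodule.span ℤ (Set.range b)
  refine ⟨torus L, ⟨hk, isFlatTorus_torus L⟩, ?_⟩
  have hinj : Function.Injective (translationHom k) := fun v w h => by
    have h1 : (0 : Euc k) + v.toAdd = 0 + w.toAdd := congrArg (fun g : EucIsom k => g 0) h
    rw [zero_add, zero_add] at h1
    exact Multiplicative.toAdd.injective h1
  let e₁ : Multiplicative L ≃* translationSubgroup L :=
    L.toAddSubgroup.toSubgroup.equivMapOfInjective _ hinj
  have e₂ : Multiplicative (Fin k → ℤ) ≃* Multiplicative L :=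
    (b.restrictScalars ℤ).equivFun.symm.toAddEquiv.toMultiplicative
  exact ⟨(e₁.symm.trans e₂.symm).trans e.symm⟩

end EuclideanSpaceForm

end Torus

/-! ### Diagonal actions on an orthogonal splitting -/

section Splitting

variable {n l m : ℕ} (J : Euc n ≃ₗᵢ[ℝ] WithLp 2 (Euc l × Euc m))

theorem dist_sq_eq_of_splitting (x y : Euc n) :
    dist x y ^ 2 = dist (J x).fst (J y).fst ^ 2 + dist (J x).snd (J y).snd ^ 2 := by
  rw [← J.dist_map, WithLp.prod_dist_eq_of_L2, Real.sq_sqrt (by positivity)]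

theorem dist_fst_le_of_splitting (x y : Euc n) : dist (J x).fst (J y).fst ≤ dist x y := by
  refine abs_le_of_sq_le_sq' ?_ dist_nonneg |>.2
  rw [dist_sq_eq_of_splitting J]
  exact le_add_of_nonneg_right (sq_nonneg _)

theorem dist_snd_le_of_splitting (x y : Euc n) : dist (J x).snd (J y).snd ≤ dist x y := by
  refine abs_le_of_sq_le_sq' ?_ dist_nonneg |>.2
  rw [dist_sq_eq_of_splitting J]
  exact le_add_of_nonneg_left (sq_nonneg _)

theorem dist_le_add_of_splitting (x y : Euc n) :
    dist x y ≤ dist (J x).fst (J y).fst + dist (J x).snd (J y).snd := by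
  refine abs_le_of_sq_le_sq' ?_ (by positivity) |>.2
  rw [dist_sq_eq_of_splitting J, add_sq]
  have : 0 ≤ 2 * dist (J x).fst (J y).fst * dist (J x).snd (J y).snd := by positivity
  linarith

/-- The point with given components in a splitting `ℝⁿ ≃ ℝˡ × ℝᵐ`. -/
noncomputable def splittingPair : Euc l × Euc m ≃ₜ Euc n :=
  (WithLp.homeomorphProd 2 (Euc l) (Euc m)).symm.trans J.symm.toHomeomorph

theorem apply_splittingPair (a : Euc l × Euc m) : J (splittingPair J a) = WithLp.toLp 2 a :=
  J.apply_symm_apply _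

theorem splittingPair_apply (x : Euc n) : splittingPair J ((J x).fst, (J x).snd) = x :=
  J.symm_apply_apply x

/-- The diagonal action on `ℝⁿ ≃ ℝˡ × ℝᵐ` of a group acting on both factors. -/
noncomputable def splittingAction {Γ : Type*} [Group Γ] (σ : Γ →* EucIsom l) (τ : Γ →* EucIsom m) :
    Γ →* EucIsom n :=
  isometricAction (fun γ x => splittingPair J (σ γ (J x).fst, τ γ (J x).snd))
    (fun x => by
      rw [map_one, map_one]
      exact splittingPair_apply J x)
    (fun a b x => by
      rw [map_mul, map_mul, apply_splittingPair]
      rfl)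
    (fun a => Isometry.of_dist_eq fun x y => by
      rw [← sq_eq_sq₀ dist_nonneg dist_nonneg, dist_sq_eq_of_splitting J,
        dist_sq_eq_of_splitting J x y, apply_splittingPair, apply_splittingPair]
      exact congrArg₂ (fun s t : ℝ => s ^ 2 + t ^ 2) ((σ a).dist_eq _ _) ((τ a).dist_eq _ _))

variable {Γ : Type*} [Group Γ] (σ : Γ →* EucIsom l) (τ : Γ →* EucIsom m)

theorem splittingAction_apply (γ : Γ) (x : Euc n) :
    splittingAction J σ τ γ x = splittingPair J (σ γ (J x).fst, τ γ (J x).snd) := rfl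

theorem splittingAction_fst (γ : Γ) (x : Euc n) :
    (J (splittingAction J σ τ γ x)).fst = σ γ (J x).fst := by
  rw [splittingAction_apply, apply_splittingPair]
  rfl

theorem splittingAction_snd (γ : Γ) (x : Euc n) :
    (J (splittingAction J σ τ γ x)).snd = τ γ (J x).snd := by
  rw [splittingAction_apply, apply_splittingPair]
  rfl

theorem splittingAction_pair (γ : Γ) (a : Euc l × Euc m) :
    splittingAction J σ τ γ (splittingPair J a) = splittingPair J (σ γ a.1, τ γ a.2) := by
  rw [splittingAction_apply, apply_splittingPair]
  rfl

end Splitting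

/-! ### The flat torus bundle defined by an action on the fiber -/

namespace EuclideanSpaceForm

section TotalSpace

variable (B : EuclideanSpaceForm) {n l : ℕ} (J : Euc n ≃ₗᵢ[ℝ] WithLp 2 (Euc l × Euc B.dim))
  {L : Submodule ℤ (Euc l)} [DiscreteTopology L] [IsZLattice ℝ L]
  {Γ : Type u} [Group Γ] {σ : Γ →* EucIsom l} {p : Γ →* B.group}
  (hp : Function.Surjective p)
  (hσ : ∀ γ, p γ = 1 → ∃ v ∈ L, ∀ x, σ γ x = x + v)
  (hL : ∀ v ∈ L, ∃ γ, p γ = 1 ∧ ∀ x, σ γ x = x + v)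
  (hinj : ∀ γ, p γ = 1 → σ γ = 1 → γ = 1)

include hσ hinj in
omit [DiscreteTopology L] [IsZLattice ℝ L] in
-- Freeness on the base component forces `p γ = 1`; then `γ` translates the fiber component by a
-- vector, which must be zero.
theorem eq_one_of_splittingAction_apply_eq (γ : Γ) (x : Euc n)
    (h : splittingAction J σ (B.group.subtype.comp p) γ x = x) : γ = 1 := by
  have h1 := splittingAction_fst J σ (B.group.subtype.comp p) γ x
  have h2 := splittingAction_snd J σ (B.group.subtype.comp p) γ x
  rw [h] at h1 h2
  have hpγ : p γ = 1 := Subtype.ext (B.free _ (p γ).2 _ h2.symm)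
  obtain ⟨v, hv, hvx⟩ := hσ γ hpγ
  rw [hvx, left_eq_add] at h1
  refine hinj γ hpγ (IsometryEquiv.ext fun y => ?_)
  rw [hvx, h1, add_zero]
  rfl

/-- The total space of the flat torus bundle over `B` defined by an action of `Γ` on the fiber. -/
noncomputable def totalSpace (hp : Function.Surjective p)
    (hσ : ∀ γ, p γ = 1 → ∃ v ∈ L, ∀ x, σ γ x = x + v)
    (hL : ∀ v ∈ L, ∃ γ, p γ = 1 ∧ ∀ x, σ γ x = x + v)
    (hinj : ∀ γ, p γ = 1 → σ γ = 1 → γ = 1) : EuclideanSpaceForm where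
  dim := n
  group := (splittingAction J σ (B.group.subtype.comp p)).range
  discrete := by
    obtain ⟨ε₁, hε₁, h₁⟩ := exists_norm_lt_of_discreteTopology L
    obtain ⟨ε₂, hε₂, h₂⟩ := B.exists_displacement (J 0).snd
    refine IsDiscreteIsomSubgroup.of_displacement 0 (min ε₁ ε₂) (lt_min hε₁ hε₂) ?_
    rintro _ ⟨γ, rfl⟩ hd
    have d1 := (dist_fst_le_of_splitting J _ _).trans_lt (hd.trans_le (min_le_left _ _))
    have d2 := (dist_snd_le_of_splitting J _ _).trans_lt (hd.trans_le (min_le_right _ _))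
    rw [splittingAction_fst] at d1
    rw [splittingAction_snd] at d2
    have hpγ : p γ = 1 := Subtype.ext (h₂ _ (p γ).2 d2)
    obtain ⟨v, hv, hvx⟩ := hσ γ hpγ
    rw [hvx, dist_self_add_left] at d1
    have : γ = 1 := hinj γ hpγ (IsometryEquiv.ext fun y => by
      rw [hvx, h₁ v hv d1, add_zero]
      rfl)
    rw [this, map_one]
  free := by
    rintro _ ⟨γ, rfl⟩ x hx
    rw [B.eq_one_of_splittingAction_apply_eq J hσ hinj γ x hx, map_one]
  compact := by
    obtain ⟨R₁, hR₁⟩ := exists_norm_add_le_of_isZLattice L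
    obtain ⟨R₂, hR₂⟩ := exists_dist_orbit_le_of_compact B.compact
    refine compactSpace_orbitSpace_of_dist_le (R₁ + R₂) fun x => ?_
    -- `γ` brings the base component near `0`; `γ'` in the kernel of `p` then corrects the fiber
    -- component without moving the base.
    obtain ⟨h, hh, hd⟩ := hR₂ (J x).snd
    obtain ⟨γ, hγ⟩ := hp ⟨h, hh⟩
    obtain ⟨v, hv, hvd⟩ := hR₁ (σ γ (J x).fst)
    obtain ⟨γ', hγ', hγ'v⟩ := hL v hv
    refine ⟨_, ⟨γ' * γ, rfl⟩, (dist_le_add_of_splitting J _ _).trans (add_le_add ?_ ?_)⟩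
    · rw [splittingAction_fst, map_zero, map_mul]
      change dist (σ γ' (σ γ (J x).fst)) 0 ≤ R₁
      rwa [hγ'v, dist_zero_right]
    · rw [splittingAction_snd, map_zero]
      change dist ((p (γ' * γ)).1 (J x).snd) 0 ≤ R₂
      rwa [map_mul, hγ', one_mul, hγ]

theorem nonempty_totalSpace_group_mulEquiv :
    Nonempty ((totalSpace B J hp hσ hL hinj).group ≃* Γ) :=
  ⟨(MonoidHom.ofInjective (f := splittingAction J σ (B.group.subtype.comp p))
    ((injective_iff_map_eq_one _).2 fun γ hγ =>
      B.eq_one_of_splittingAction_apply_eq J hσ hinj γ 0 (by rw [hγ]; rfl))).symm⟩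

theorem geometricallyFibers_totalSpace :
    (totalSpace B J hp hσ hL hinj).GeometricallyFibers B (torus L) := by
  set M := totalSpace B J hp hσ hL hinj
  let τ : Γ →* EucIsom B.dim := B.group.subtype.comp p
  let act : Γ →* EucIsom n := splittingAction J σ τ
  have projM : ∀ {a b : Euc n}, M.proj a = M.proj b ↔ ∃ γ, act γ b = a := fun {a b} => by
    refine (proj_eq_proj (M := M)).trans ⟨?_, ?_⟩
    · rintro ⟨_, ⟨γ, rfl⟩, h⟩
      exact ⟨γ, h⟩
    · rintro ⟨γ, h⟩
      exact ⟨_, ⟨γ, rfl⟩, h⟩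
  have projF : ∀ {a b : Euc l}, (torus L).proj a = (torus L).proj b ↔ ∃ v ∈ L, b + v = a :=
    fun {a b} => by
      refine (proj_eq_proj (M := torus L)).trans ⟨?_, ?_⟩
      · rintro ⟨g, hg, h⟩
        obtain ⟨v, hv, hgv⟩ := mem_translationSubgroup.1 hg
        exact ⟨v, hv, (hgv b).symm.trans h⟩
      · rintro ⟨v, hv, h⟩
        exact ⟨IsometryEquiv.addRight v, mem_translationSubgroup.2 ⟨v, hv, fun _ => rfl⟩, h⟩
  let η : M.Carrier → B.Carrier := Quotient.lift (fun x : Euc n => B.proj (J x).snd) (by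
    intro a b hab
    obtain ⟨γ, rfl⟩ := projM.1 (Quotient.sound hab : M.proj a = M.proj b)
    exact (congrArg B.proj (splittingAction_snd J σ τ γ b)).trans (proj_apply_mem (p γ).2 _))
  have hηp : ∀ x : Euc n, η (M.proj x) = B.proj (J x).snd := fun _ => rfl
  have hηpair : ∀ a : Euc l × Euc B.dim, η (M.proj (splittingPair J a)) = B.proj a.2 := fun a => by
    rw [hηp, apply_splittingPair]
    rfl
  have hη : Continuous η := by
    refine (M.isQuotientCoveringMap.toIsQuotientMap.continuous_iff).2 ?_
    have : Continuous fun x : Euc n => (J x).snd :=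
      (WithLp.sndL 2 ℝ (Euc l) (Euc B.dim)).continuous.comp J.continuous
    exact B.continuous_proj.comp this
  refine ⟨η, hη, fun y => ?_, fun y => ?_⟩
  · obtain ⟨w, rfl⟩ := B.proj_surjective y
    exact ⟨M.proj (splittingPair J (0, w)), hηpair _⟩
  obtain ⟨w₀, rfl⟩ := B.proj_surjective y
  obtain ⟨r, hr, hBd⟩ := B.exists_orbitDist_proj_eq w₀
  refine ⟨r, hr, ?_⟩
  set U := B.metricBall (B.proj w₀) r
  have hUeq : U = B.proj '' Metric.ball w₀ r := B.metricBall_proj w₀ r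
  have hwU : ∀ w : Metric.ball w₀ r, B.proj w ∈ U := fun w => by
    rw [hUeq]
    exact ⟨w, w.2, rfl⟩
  let inc : Euc l × Metric.ball w₀ r → Euc l × Euc B.dim := Prod.map id Subtype.val
  have hinc : IsOpenMap inc := IsOpenMap.id.prodMap Metric.isOpen_ball.isOpenMap_subtype_val
  have hincc : Continuous inc := continuous_id.prodMap continuous_subtype_val
  -- Both sides of the trivialization are open quotients of `ℝˡ × ball`, via `Ψ` and `Θ`; it remains
  -- to see that the two maps make the same identifications.
  let Ψ : Euc l × Metric.ball w₀ r → η ⁻¹' U := fun a =>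
    ⟨M.proj (splittingPair J (inc a)), by rw [Set.mem_preimage, hηpair]; exact hwU a.2⟩
  let Θ : Euc l × Metric.ball w₀ r → (torus L).Carrier × U :=
    Prod.map (torus L).proj fun w => ⟨B.proj w, hwU w⟩
  have hΨc : Continuous Ψ :=
    (M.continuous_proj.comp ((splittingPair J).continuous.comp hincc)).subtype_mk _
  have hΨo : IsOpenMap Ψ :=
    (M.isOpenMap_proj.comp ((splittingPair J).isOpenMap.comp hinc)).subtype_mk _
  have hΘc : Continuous Θ := (torus L).continuous_proj.prodMap
    ((B.continuous_proj.comp continuous_subtype_val).subtype_mk _)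
  have hΘo : IsOpenMap Θ := (torus L).isOpenMap_proj.prodMap
    ((B.isOpenMap_proj.comp Metric.isOpen_ball.isOpenMap_subtype_val).subtype_mk _)
  have hΨs : Function.Surjective Ψ := by
    rintro ⟨q, hq⟩
    obtain ⟨x, rfl⟩ := M.proj_surjective q
    have hq' : B.proj (J x).snd ∈ U := hq
    rw [hUeq] at hq'
    obtain ⟨w, hw, hwx⟩ := hq'
    obtain ⟨h, hh, hhw⟩ := proj_eq_proj.1 hwx
    obtain ⟨γ, hγ⟩ := hp ⟨h, hh⟩
    refine ⟨(σ γ (J x).fst, ⟨w, hw⟩), Subtype.ext (projM.2 ⟨γ, ?_⟩)⟩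
    change splittingPair J (σ γ (J x).fst, (p γ).1 (J x).snd) = splittingPair J (_, w)
    rw [hγ, hhw]
    rfl
  have hΘs : Function.Surjective Θ := by
    refine (torus L).proj_surjective.prodMap ?_
    rintro ⟨z, hz⟩
    have hz' := hz
    rw [hUeq] at hz'
    obtain ⟨w, hw, rfl⟩ := hz'
    exact ⟨⟨w, hw⟩, rfl⟩
  obtain ⟨φ, hφ⟩ := exists_homeomorph_of_isQuotientMap
    (hΨo.isQuotientMap hΨc hΨs) (hΘo.isQuotientMap hΘc hΘs) (by
      rintro ⟨v, w⟩ ⟨v', w'⟩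
      constructor
      · intro h
        obtain ⟨γ, hγ⟩ := projM.1 (congrArg Subtype.val h)
        rw [splittingAction_pair] at hγ
        have h1 : σ γ v' = v := congrArg Prod.fst ((splittingPair J).injective hγ)
        have h2 : (p γ).1 w'.1 = w.1 := congrArg Prod.snd ((splittingPair J).injective hγ)
        have hww : B.proj w = B.proj w' := by rw [← h2, proj_apply_mem (p γ).2]
        -- `B.proj` is injective on the ball, so an element `γ` identifying two points over it has
        -- `p γ = 1`: only the lattice acts.
        have hww' : w.1 = w'.1 := eq_of_proj_eq hBd w.2 w'.2 hww
        have hpγ : p γ = 1 := Subtype.ext (B.free _ (p γ).2 _ (h2.trans hww'))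
        obtain ⟨u, hu, huv⟩ := hσ γ hpγ
        exact Prod.ext (projF.2 ⟨u, hu, by rw [← huv, h1]⟩) (Subtype.ext hww)
      · intro h
        have h1 : (torus L).proj v = (torus L).proj v' := congrArg Prod.fst h
        have h2 : B.proj w = B.proj w' := congrArg (fun q => (Prod.snd q).1) h
        have hww' : w.1 = w'.1 := eq_of_proj_eq hBd w.2 w'.2 h2
        obtain ⟨u, hu, huv⟩ := projF.1 h1
        obtain ⟨γ, hγ, hγu⟩ := hL u hu
        refine Subtype.ext (projM.2 ⟨γ, ?_⟩)
        rw [splittingAction_pair]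
        change splittingPair J (σ γ v', (p γ).1 w'.1) = splittingPair J (v, w.1)
        rw [hγu, huv, hγ, hww']
        rfl)
  refine ⟨φ, fun q => ?_, fun q => ?_⟩
  · obtain ⟨a, rfl⟩ := hΨs q
    rw [hφ]
    exact (hηpair (inc a)).symm
  · obtain ⟨a, rfl⟩ := hΨs q
    obtain ⟨ε₁, hε₁, h₁⟩ := M.exists_orbitDist_proj_eq (splittingPair J (inc a))
    obtain ⟨ε₂, hε₂, h₂⟩ := (torus L).exists_orbitDist_proj_eq a.1
    have hO : IsOpen {b : Euc l × Metric.ball w₀ r |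
        splittingPair J (inc b) ∈ Metric.ball (splittingPair J (inc a)) ε₁ ∧
          b.1 ∈ Metric.ball a.1 ε₂} :=
      (Metric.isOpen_ball.preimage ((splittingPair J).continuous.comp hincc)).inter
        (Metric.isOpen_ball.preimage continuous_fst)
    -- On this neighbourhood all three covering maps are isometric, and the claim is Pythagoras in
    -- the splitting `J`.
    refine ⟨_, (hΨo _ hO).mem_nhds
      ⟨a, ⟨Metric.mem_ball_self hε₁, Metric.mem_ball_self hε₂⟩, rfl⟩, ?_⟩
    rintro _ _ ⟨b, hb, rfl⟩ ⟨c, hc, rfl⟩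
    have e1 : orbitDist (Ψ b).1 (Ψ c).1 = dist (splittingPair J (inc b)) (splittingPair J (inc c)) :=
      h₁ _ hb.1 _ hc.1
    have e2 : orbitDist (Θ b).1 (Θ c).1 = dist b.1 c.1 := h₂ _ hb.2 _ hc.2
    have e3 : orbitDist ((Θ b).2 : B.Carrier) ((Θ c).2 : B.Carrier) = dist b.2.1 c.2.1 :=
      hBd _ b.2.2 _ c.2.2
    rw [hφ, hφ, e1, e2, e3, dist_sq_eq_of_splitting J, apply_splittingPair, apply_splittingPair]
    rfl

end TotalSpace

theorem exists_geometricallyFibers (B : EuclideanSpaceForm) {l : ℕ}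
    (L : Submodule ℤ (Euc l)) [DiscreteTopology L] [IsZLattice ℝ L]
    {Γ : Type u} [Group Γ] (σ : Γ →* EucIsom l) (p : Γ →* B.group)
    (hp : Function.Surjective p)
    (hσ : ∀ γ, p γ = 1 → ∃ v ∈ L, ∀ x, σ γ x = x + v)
    (hL : ∀ v ∈ L, ∃ γ, p γ = 1 ∧ ∀ x, σ γ x = x + v)
    (hinj : ∀ γ, p γ = 1 → σ γ = 1 → γ = 1) :
    ∃ M : EuclideanSpaceForm, Nonempty (M.group ≃* Γ) ∧ M.GeometricallyFibers B (torus L) :=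
  let J := (stdOrthonormalBasis ℝ (WithLp 2 (Euc l × Euc B.dim))).repr.symm
  ⟨totalSpace B J hp hσ hL hinj, nonempty_totalSpace_group_mulEquiv B J hp hσ hL hinj,
    geometricallyFibers_totalSpace B J hp hσ hL hinj⟩

end EuclideanSpaceForm

/-! ### The action on the span of a normal translation subgroup -/

section FiberAction

variable {n : ℕ} {Γ : Type u} [Group Γ] (ρ : Γ →* EucIsom n) (N : Subgroup Γ)

/-- Conjugating the translation by `v` with `ρ γ` gives the translation by `A v`. -/
theorem linear_mem_translationVectors [N.Normal] {γ : Γ} {A : Euc n ≃ₗᵢ[ℝ] Euc n}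
    (hA : ∀ x y, ρ γ y = ρ γ x + A (y - x)) {v : Euc n} (hv : v ∈ translationVectors (N.map ρ)) :
    A v ∈ translationVectors (N.map ρ) := by
  obtain ⟨_, ⟨k, hk, rfl⟩, hkv⟩ := hv
  refine ⟨_, ⟨γ * k * γ⁻¹, Subgroup.Normal.conj_mem ‹_› k hk γ, rfl⟩, fun x => ?_⟩
  have e : ρ γ (ρ γ⁻¹ x) = x := by
    rw [map_inv]
    exact (ρ γ).apply_symm_apply x
  rw [map_mul, map_mul]
  change ρ γ (ρ k (ρ γ⁻¹ x)) = _
  rw [hkv, hA (ρ γ⁻¹ x), e, add_sub_cancel_left]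

variable {ρ N}

/-- A normal subgroup acting by translations yields a lattice in the span of its translation
vectors, and an action of the whole group on this span, identified with a Euclidean space. -/
theorem exists_fiber_action [N.Normal] (hρ : Function.Injective ρ)
    (hdisc : IsDiscreteIsomSubgroup ρ.range) (hN : ∀ γ ∈ N, IsTranslation (ρ γ)) :
    ∃ (k : ℕ) (L : Submodule ℤ (Euc k)) (_ : DiscreteTopology L) (_ : IsZLattice ℝ L)
      (σ : Γ →* EucIsom k), (∀ γ ∈ N, ∃ v ∈ L, ∀ x, σ γ x = x + v) ∧
        (∀ v ∈ L, ∃ γ ∈ N, ∀ x, σ γ x = x + v) ∧ ∀ γ ∈ N, σ γ = 1 → γ = 1 := by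
  let L₀ : Submodule ℤ (Euc n) := translationVectors (N.map ρ)
  have hd₀ : DiscreteTopology L₀ := discreteTopology_translationVectors
    (hdisc.mono (by rintro _ ⟨γ, -, rfl⟩; exact ⟨γ, rfl⟩))
  let V : Submodule ℝ (Euc n) := Submodule.span ℝ (L₀ : Set (Euc n))
  let J : V ≃ₗᵢ[ℝ] Euc (Module.finrank ℝ V) := (stdOrthonormalBasis ℝ V).repr
  let L₁ : Submodule ℤ V := ZLattice.comap ℝ L₀ V.subtype
  have hd₁ : DiscreteTopology L₁ :=
    ZLattice.comap_discreteTopology ℝ L₀ continuous_subtype_val Subtype.val_injective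
  have hz₁ : IsZLattice ℝ L₁ := ⟨by
    have hsub : (L₀ : Set (Euc n)) ⊆ LinearMap.range V.subtype := by
      rw [Submodule.range_subtype]
      exact Submodule.subset_span
    rw [ZLattice.coe_comap, Submodule.span_preimage_eq (Submodule.nonempty L₀) hsub]
    exact Submodule.comap_subtype_self V⟩
  let Je : Euc (Module.finrank ℝ V) ≃L[ℝ] V := J.symm.toContinuousLinearEquiv
  let L := ZLattice.comap ℝ L₁ Je.toLinearMap
  have hmemL : ∀ v, v ∈ L ↔ ((J.symm v : V) : Euc n) ∈ L₀ := fun v => Iff.rfl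
  choose A hA using fun γ => IsometryEquiv.exists_apply_eq_linear (ρ γ)
  have hAV : ∀ γ, ∀ v ∈ V, A γ v ∈ V := by
    intro γ
    have : V ≤ V.comap ((A γ).toLinearEquiv : Euc n →ₗ[ℝ] Euc n) := Submodule.span_le.2 fun v hv =>
      Submodule.subset_span (linear_mem_translationVectors ρ N (hA γ) hv)
    exact this
  have hinv : ∀ γ x, ρ γ (ρ γ⁻¹ x) = x := fun γ x => by
    rw [map_inv]
    exact (ρ γ).apply_symm_apply x
  have hAinv : ∀ γ v, A γ (A γ⁻¹ v) = v := fun γ v => by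
    have h1 := hA γ⁻¹ 0 v
    have h2 := hA γ (ρ γ⁻¹ 0) (ρ γ⁻¹ v)
    rw [hinv, hinv, zero_add, h1, add_sub_cancel_left, sub_zero] at h2
    exact h2.symm
  -- As `A γ⁻¹` also preserves `V`, the isometry `A γ` preserves the orthogonal complement.
  have hAVo : ∀ γ, ∀ v ∈ Vᗮ, A γ v ∈ Vᗮ := by
    intro γ v hv
    rw [Submodule.mem_orthogonal] at hv ⊢
    intro u hu
    rw [← hAinv γ u, (A γ).inner_map_map]
    exact hv _ (hAV γ⁻¹ u hu)
  let P : Euc n →L[ℝ] V := V.orthogonalProjectionOnto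
  have hPV : ∀ v : V, P v = v := fun v => V.orthogonalProjectionOnto_mem_subspace_eq_self v
  have hPo : ∀ v ∈ Vᗮ, P v = 0 := fun v hv =>
    Submodule.orthogonalProjectionOnto_eq_zero_iff.2 hv
  have hsub : ∀ v, v - P v ∈ Vᗮ := fun v => V.sub_starProjection_mem_orthogonal v
  -- Discarding the `Vᗮ`-component before applying `ρ γ` does not change the `V`-component after;
  -- this makes `σ` multiplicative.
  have hPρ : ∀ γ x, P (ρ γ (P x)) = P (ρ γ x) := fun γ x => by
    rw [hA γ (P x) x, map_add, hPo _ (hAVo γ _ (hsub x)), add_zero]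
  let σ : Γ →* EucIsom (Module.finrank ℝ V) := isometricAction
    (fun γ x => J (P (ρ γ (J.symm x : V))))
    (fun x => by
      rw [map_one]
      change J (P (J.symm x : V)) = x
      rw [hPV, J.apply_symm_apply])
    (fun a b x => by
      rw [map_mul, J.symm_apply_apply, hPρ]
      rfl)
    (fun γ => Isometry.of_dist_eq fun x y => by
      have h1 : P (A γ ((J.symm y : V) - (J.symm x : V) : Euc n)) =
          ⟨A γ ((J.symm y : V) - (J.symm x : V) : Euc n),
            hAV γ _ (V.sub_mem (J.symm y).2 (J.symm x).2)⟩ := hPV ⟨_, _⟩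
      rw [J.dist_map, hA γ (J.symm x : V) (J.symm y : V), map_add, dist_self_add_right, h1]
      change ‖A γ ((J.symm y : V) - (J.symm x : V) : Euc n)‖ = _
      rw [(A γ).norm_map, ← dist_eq_norm, dist_comm]
      exact J.symm.dist_map x y)
  have hσ : ∀ γ v (hv : v ∈ L₀), (∀ x, ρ γ x = x + v) →
      ∀ x, σ γ x = x + J ⟨v, Submodule.subset_span hv⟩ := by
    intro γ v hv hγ x
    change J (P (ρ γ (J.symm x : V))) = _
    have h1 : P v = ⟨v, Submodule.subset_span hv⟩ := hPV ⟨v, Submodule.subset_span hv⟩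
    rw [hγ, map_add, hPV, map_add, J.apply_symm_apply, h1]
  refine ⟨_, L, inferInstance, inferInstance, σ, fun γ hγ => ?_, fun v hv => ?_, fun γ hγ h => ?_⟩
  · obtain ⟨v, hv⟩ := hN γ hγ
    have hvL : v ∈ L₀ := ⟨_, ⟨γ, hγ, rfl⟩, hv⟩
    refine ⟨J ⟨v, Submodule.subset_span hvL⟩, ?_, hσ γ v hvL hv⟩
    rw [hmemL, J.symm_apply_apply]
    exact hvL
  · have hv' := (hmemL v).1 hv
    obtain ⟨_, ⟨γ, hγ, rfl⟩, hγv⟩ := hv'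
    refine ⟨γ, hγ, fun x => ?_⟩
    rw [hσ γ _ ((hmemL v).1 hv) hγv x]
    congr 1
    exact J.apply_symm_apply v
  · obtain ⟨v, hv⟩ := hN γ hγ
    have hvL : v ∈ L₀ := ⟨_, ⟨γ, hγ, rfl⟩, hv⟩
    have h1 := hσ γ v hvL hv 0
    rw [h, zero_add] at h1
    have h2 : J ⟨v, Submodule.subset_span hvL⟩ = 0 := h1.symm
    rw [map_eq_zero_iff _ J.injective] at h2
    have h3 : v = 0 := congrArg Subtype.val h2
    refine hρ ?_
    rw [map_one]
    ext1 x
    rw [hv, h3, add_zero]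
    rfl

end FiberAction

/-! ### From the class `𝒵` to iterated torus bundles, and the conclusion -/

/-- The bundle is not `ℝⁿ/ρ(Γ)`: `ρ` supplies only the fiber action, and the base directions come
from the space form obtained for `Γ'` by induction. -/
theorem exists_isIteratedTorusBundle_of_isClassZ : ∀ (i : ℕ) (Γ : Type u) [Group Γ],
    IsClassZ i Γ → ∃ E : EuclideanSpaceForm, E.IsIteratedTorusBundle i ∧ Nonempty (E.group ≃* Γ)
  | 0, _, _, h => EuclideanSpaceForm.exists_torus_of_isClassZ_zero h
  | i + 1, Γ, _, ⟨_, n, ρ, hρ, l, Γ', _, ι, p, _, hp, hker, hΓ', htr⟩ => by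
    obtain ⟨B, hB, ⟨e⟩⟩ := exists_isIteratedTorusBundle_of_isClassZ i Γ' hΓ'
    obtain ⟨k, L, _, _, σ, h1, h2, h3⟩ := exists_fiber_action (N := p.ker) hρ.injective hρ.discrete
      (fun γ hγ => by
        rw [← hker] at hγ
        obtain ⟨z, rfl⟩ := hγ
        exact htr z)
    have hmem : ∀ γ, (e.symm.toMonoidHom.comp p) γ = 1 ↔ γ ∈ p.ker := fun γ => by
      rw [MonoidHom.mem_ker]
      exact e.symm.map_eq_one_iff
    obtain ⟨M, hM, hfib⟩ := B.exists_geometricallyFibers L σ (e.symm.toMonoidHom.comp p)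
      (e.symm.surjective.comp hp) (fun γ hγ => h1 γ ((hmem γ).1 hγ))
      (fun v hv => let ⟨γ, hγ, h⟩ := h2 v hv; ⟨γ, (hmem γ).2 hγ, h⟩)
      (fun γ hγ => h3 γ ((hmem γ).1 hγ))
    exact ⟨M, ⟨B, _, hB, EuclideanSpaceForm.isFlatTorus_torus L, hfib⟩, hM⟩

theorem mainTheorem7 (Γ : Type u) [Group Γ] :
    (∃ i : ℕ, IsClassZ i Γ) ↔
      ∃ (i : ℕ) (E : EuclideanSpaceForm), E.IsIteratedTorusBundle i ∧
        ∃ x : E.Carrier, Nonempty (FundamentalGroup E.Carrier x ≃* Γ) := by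
  constructor
  · rintro ⟨i, h⟩
    obtain ⟨E, hE, ⟨e⟩⟩ := exists_isIteratedTorusBundle_of_isClassZ i Γ h
    obtain ⟨e'⟩ := E.nonempty_fundamentalGroup_mulEquiv (E.proj 0)
    exact ⟨i, E, hE, E.proj 0, ⟨e'.trans e⟩⟩
  · rintro ⟨i, E, hE, x, ⟨e⟩⟩
    obtain ⟨e'⟩ := E.nonempty_fundamentalGroup_mulEquiv x
    exact ⟨i, EuclideanSpaceForm.isClassZ_of_isIteratedTorusBundle i E hE Γ (e'.symm.trans e)⟩
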